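/- Let $L$ and $N$ be positive integers, and for a positive integer $\beta$ let $$C_N=C_N(\beta)=\frac1{N!}\int_{[-\pi,\pi)^N}\prod_{m<n}\bigl|e^{i\theta_n}-e^{i\theta_m}\bigr|^{\beta}\,d\theta_1\cdots d\theta_N$$ be the partition function of Dyson's circular ensemble, and let $\mu=\mu_{N,\beta}$ be the complex measure on $[-\pi,\pi)$ $$d\mu(\theta)=(-ie^{-i\theta})^{\beta(N-1)/2}\,d\theta:=e^{-i(\theta+\pi/2)\beta(N-1)/2}\,d\theta .$$ Let $\mathbf p=(p_n)_{n=1}^{NL}$ be any family of monic polynomials in $\mathbb C[x]$ with $\deg p_n=n-1$. Let $V=\mathbb C^{NL}$ with standard basis $\mathbf e_1,\dots,\mathbf e_{NL}$; for an increasing map $\mathfrak t:\{1,\dots,L\}\to\{1,\dots,NL\}$ put $\epsilon_{\mathfrak t}=\mathbf e_{\mathfrak t(1)}\wedge\cdots\wedge\mathbf e_{\mathfrak t(L)}$ and $$\mathrm{Wr}(\mathbf p_{\mathfrak t};x)=\det\Bigl[\tfrac1{(\ell-1)!}\,p_{\mathfrak t(n)}^{(\ell-1)}(x)\Bigr]_{n,\ell=1}^{L},\qquad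 \omega(x)=\sum_{\mathfrak t}\mathrm{Wr}(\mathbf p_{\mathfrak t};x)\,\epsilon_{\mathfrak t}\in\Lambda^LV .$$ Let $V'=\mathbb C^{(N+1)L}\supset V$ and $\epsilon'=\mathbf e_{NL+1}\wedge\cdots\wedge\mathbf e_{NL+L}$. Forms are integrated coefficientwise. For a $d$-form $\alpha$ on $\mathbb C^{kd}$ the hyperpfaffian $\mathrm{PF}\,\alpha$ is defined by $\alpha^{\wedge k}/k!=\mathrm{PF}\,\alpha\cdot\mathbf e_1\wedge\cdots\wedge\mathbf e_{kd}$. Then: 1. if $\beta=L^2$ is even, $$C_N=\mathrm{PF}\Bigl(\int_{-\pi}^{\pi}\omega(e^{i\theta})\,d\mu(\theta)\Bigr);$$ 2. if $\beta=L^2$ is odd and $N$ is even, $$C_N=\mathrm{PF}\Bigl(\frac12\int_{-\pi}^{\pi}\!\int_{-\pi}^{\pi}\omega(e^{i\theta})\wedge\omega(e^{i\psi})\,\mathrm{sgn}(\psi-\theta)\,d\mu(\theta)\,d\mu(\psi)\Bigr);$$ 3. if $\beta=L^2$ is odd and $N$ is odd, then, with the hyperpfaffian taken on $V'$, $$C_N=\mathrm{PF}\Bigl(\frac12\int_{-\pi}^{\pi}\!\int_{-\pi}^{\pi}\omega(e^{i\theta})\wedge\omega(e^{i\psi})\,\mathrm{sgn}(\psi-\theta)\,d\mu(\theta)\,d\mu(\psi)+\int_{-\pi}^{\pi}\omega(e^{i\theta})\wedge\epsilon'\,d\mu(\theta)\Bigr);$$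 4. if $\beta=L^2+1$ is even and $N=2M$ is even, $$C_N=\mathrm{PF}\Bigl(\frac12\int_{-\pi}^{\pi}\!\int_{-\pi}^{\pi}\omega(e^{i\theta})\wedge\omega(e^{i\psi})\,\frac{(e^{iM\psi}-e^{iM\theta})^2}{e^{i\psi}-e^{i\theta}}\,d\mu(\theta)\,d\mu(\psi)\Bigr).$$ -/

import Mathlib

open scoped Polynomial

noncomputable section

/-- Dyson's circular partition function
`C_N = (1/N!) ∫_{[-π,π)^N} ∏_{m<n} |e^{iθ_n} - e^{iθ_m}|^β dθ_1 ⋯ dθ_N`. -/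
def circularPartition (N β : ℕ) : ℝ :=
  (1 / (N.factorial : ℝ)) *
    ∫ θ in Set.univ.pi (fun _ : Fin N => Set.Ico (-Real.pi) Real.pi),
      ∏ m : Fin N, ∏ n ∈ Finset.Ioi m,
        ‖Complex.exp (Complex.I * (θ n : ℂ)) - Complex.exp (Complex.I * (θ m : ℂ))‖ ^ β

/-- The density `(-i e^{-iθ})^{β(N-1)/2}`. Where the exponent is a half-integer, the power is the
branch that is continuous on `[-π,π)`, so that `-i e^{-iθ} = e^{-i(θ + π/2)}` is raised to a power
by multiplying its argument `-(θ + π/2)`. -/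
def circularDensity (N β : ℕ) (θ : ℝ) : ℂ :=
  Complex.exp (-Complex.I * ((θ : ℂ) + (Real.pi : ℂ) / 2) * ((β : ℂ) * ((N : ℂ) - 1) / 2))

/-- The square of the density is `(-i e^{-iθ})^{β(N-1)}`. -/
theorem circularDensity_sq (N β : ℕ) (hN : 0 < N) (θ : ℝ) :
    circularDensity N β θ ^ 2 =
      (-Complex.I * Complex.exp (-Complex.I * (θ : ℂ))) ^ (β * (N - 1)) := by
  have h : -Complex.I * Complex.exp (-Complex.I * (θ : ℂ)) =
      Complex.exp (-Complex.I * ((θ : ℂ) + (Real.pi : ℂ) / 2)) := by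
    have h2 : -Complex.I * ((θ : ℂ) + (Real.pi : ℂ) / 2) =
        -((Real.pi : ℂ) / 2 * Complex.I) + -Complex.I * (θ : ℂ) := by ring
    rw [h2, Complex.exp_add, Complex.exp_neg, Complex.exp_pi_div_two_mul_I, Complex.inv_I]
  rw [h, circularDensity, ← Complex.exp_nat_mul, ← Complex.exp_nat_mul]
  congr 1
  push_cast [Nat.cast_sub (Nat.one_le_of_lt hN)]
  ring

/-- The integral `∫_{-π}^{π} f(θ) dμ(θ)` against the complex measure
`dμ(θ) = (-i e^{-iθ})^{β(N-1)/2} dθ` on `[-π,π)`. -/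
def circularIntegral (N β : ℕ) (f : ℝ → ℂ) : ℂ :=
  ∫ θ in Set.Ico (-Real.pi) Real.pi, f θ * circularDensity N β θ

/-- `𝐞_{t(1)} ∧ ⋯ ∧ 𝐞_{t(L)}` in the exterior algebra of `ℂⁿ`. -/
def wedgeBasis {n L : ℕ} (t : Fin L → Fin n) : ExteriorAlgebra ℂ (Fin n → ℂ) :=
  ExteriorAlgebra.ιMulti ℂ L (fun l => (Pi.single (t l) 1 : Fin n → ℂ))

/-- The volume form `𝐞_1 ∧ ⋯ ∧ 𝐞_n`. -/
def volumeForm (n : ℕ) : ExteriorAlgebra ℂ (Fin n → ℂ) :=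
  wedgeBasis (fun i : Fin n => i)

/-- The coefficient of the volume form of `ℂⁿ` in an element of the exterior algebra. -/
def volumeCoeff (n : ℕ) : ExteriorAlgebra ℂ (Fin n → ℂ) →ₗ[ℂ] ℂ :=
  ExteriorAlgebra.liftAlternating (R := ℂ)
    (Pi.single n (Pi.basisFun ℂ (Fin n)).det :
      ∀ i, (Fin n → ℂ) [⋀^Fin i]→ₗ[ℂ] ℂ)

theorem volumeCoeff_ιMulti {n : ℕ} (v : Fin n → Fin n → ℂ) :
    volumeCoeff n (ExteriorAlgebra.ιMulti ℂ n v) = (Pi.basisFun ℂ (Fin n)).det v := by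
  rw [volumeCoeff, ExteriorAlgebra.liftAlternating_apply_ιMulti, Pi.single_eq_same]

theorem eq_volumeCoeff_smul {n : ℕ} (x : ExteriorAlgebra ℂ (Fin n → ℂ))
    (hx : x ∈ ⋀[ℂ]^n (Fin n → ℂ)) : x = volumeCoeff n x • volumeForm n := by
  rw [← ExteriorAlgebra.ιMulti_span_fixedDegree] at hx
  induction hx using Submodule.span_induction with
  | mem x hx =>
    obtain ⟨v, rfl⟩ := hx
    rw [volumeCoeff_ιMulti]
    have h : ExteriorAlgebra.ιMulti ℂ n =
        (LinearMap.toSpanSingleton ℂ _ (volumeForm n)).compAlternatingMap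
          (Pi.basisFun ℂ (Fin n)).det := by
      refine Module.Basis.ext_alternating (Pi.basisFun ℂ (Fin n)) fun v hv => ?_
      obtain ⟨σ, rfl⟩ : ∃ σ : Equiv.Perm (Fin n), v = σ :=
        ⟨Equiv.ofBijective v (Finite.injective_iff_bijective.1 hv), rfl⟩
      change ExteriorAlgebra.ιMulti ℂ n ((Pi.basisFun ℂ (Fin n)) ∘ σ) =
        (Pi.basisFun ℂ (Fin n)).det ((Pi.basisFun ℂ (Fin n)) ∘ σ) • volumeForm n
      rw [AlternatingMap.map_perm, AlternatingMap.map_perm, Module.Basis.det_self, volumeForm,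
        wedgeBasis, smul_assoc, one_smul]
      congr 2
      ext i
      simp
    exact congrArg (fun f => f v) h
  | zero => simp
  | add x y _ _ hx hy => rw [map_add, add_smul, ← hx, ← hy]
  | smul a x _ hx => rw [map_smul, smul_assoc, ← hx]

/-- The hyperpfaffian of a form `ω` on `ℂⁿ` of degree `n / k`: the coefficient of the volume form
in `ω^{∧k} / k!`. -/
def hyperpfaffian {n : ℕ} (k : ℕ) (ω : ExteriorAlgebra ℂ (Fin n → ℂ)) : ℂ :=
  volumeCoeff n ((1 / (k.factorial : ℂ)) • ω ^ k)

/-- The defining property of the hyperpfaffian. -/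
theorem hyperpfaffian_spec {n k d : ℕ} (hn : d * k = n) (ω : ExteriorAlgebra ℂ (Fin n → ℂ))
    (hω : ω ∈ ⋀[ℂ]^d (Fin n → ℂ)) :
    (1 / (k.factorial : ℂ)) • ω ^ k = hyperpfaffian k ω • volumeForm n := by
  refine eq_volumeCoeff_smul _ (Submodule.smul_mem _ _ ?_)
  have h := Submodule.pow_mem_pow _ hω k
  rw [← pow_mul, hn] at h
  exact h

/-- A complete family of monic polynomials: `p_i` is monic of degree `i`, indices starting at `0`. -/
def IsCompleteMonic {n : ℕ} (p : Fin n → ℂ[X]) : Prop :=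
  ∀ i, (p i).Monic ∧ (p i).natDegree = i

/-- The Wronskian `Wr(q; x) = det [D^ℓ q_n(x)]` with `D^ℓ = (1/ℓ!) d^ℓ/dx^ℓ`, `0 ≤ ℓ < L`. -/
def wronskian {L : ℕ} (q : Fin L → ℂ[X]) (x : ℂ) : ℂ :=
  (Matrix.of fun n l : Fin L =>
    (1 / ((l : ℕ).factorial : ℂ)) * (Polynomial.derivative^[(l : ℕ)] (q n)).eval x).det

/-- `Wr(𝐩_t; e^{iθ})`, the coefficient of `ω(e^{iθ})` at `ε_t`. -/
def wronskianAt {n L : ℕ} (p : Fin n → ℂ[X]) (t : Fin L ↪o Fin n) (θ : ℝ) : ℂ :=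
  wronskian (fun l => p (t l)) (Complex.exp (Complex.I * (θ : ℂ)))

/-- The form `∫ ω(e^{iθ}) dμ(θ)`, integrated coefficientwise. -/
def singleForm (N L β : ℕ) (p : Fin (N * L) → ℂ[X]) :
    ExteriorAlgebra ℂ (Fin (N * L) → ℂ) :=
  ∑ t : Fin L ↪o Fin (N * L), circularIntegral N β (wronskianAt p t) • wedgeBasis t

/-- The form `(1/2) ∫∫ ω(e^{iθ}) ∧ ω(e^{iψ}) κ(θ,ψ) dμ(θ) dμ(ψ)`, integrated coefficientwise. -/
def doubleForm (N L β : ℕ) (p : Fin (N * L) → ℂ[X]) (κ : ℝ → ℝ → ℂ) :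
    ExteriorAlgebra ℂ (Fin (N * L) → ℂ) :=
  ∑ t : Fin L ↪o Fin (N * L), ∑ u : Fin L ↪o Fin (N * L),
    ((1 / 2 : ℂ) * circularIntegral N β (fun ψ => circularIntegral N β (fun θ =>
      wronskianAt p t θ * wronskianAt p u ψ * κ θ ψ))) • (wedgeBasis t * wedgeBasis u)

/-- The inclusion `Λ(ℂ^{NL}) → Λ(ℂ^{(N+1)L})` that sends `𝐞_i` to `𝐞_i`. -/
def extendForm (N L : ℕ) :
    ExteriorAlgebra ℂ (Fin (N * L) → ℂ) →ₐ[ℂ] ExteriorAlgebra ℂ (Fin ((N + 1) * L) → ℂ) :=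
  ExteriorAlgebra.map ((Pi.basisFun ℂ (Fin (N * L))).constr ℂ (fun i =>
    (Pi.single (Fin.castLE (Nat.mul_le_mul_right L (Nat.le_succ N)) i) 1 :
      Fin ((N + 1) * L) → ℂ)))

/-- `ε' = 𝐞_{NL+1} ∧ ⋯ ∧ 𝐞_{NL+L}` in `Λ(ℂ^{(N+1)L})`. -/
def borderForm (N L : ℕ) : ExteriorAlgebra ℂ (Fin ((N + 1) * L) → ℂ) :=
  wedgeBasis (fun l : Fin L => Fin.cast (Nat.succ_mul N L).symm (Fin.natAdd (N * L) l))

/-- The kernel `sgn(ψ - θ)`. -/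
def signKernel (θ ψ : ℝ) : ℂ := (Real.sign (ψ - θ) : ℂ)

/-- The kernel `(e^{iMψ} - e^{iMθ})² / (e^{iψ} - e^{iθ})`, with value `0` at `e^{iψ} = e^{iθ}`
(which is also its continuous extension). -/
def powerKernel (M : ℕ) (θ ψ : ℝ) : ℂ :=
  (Complex.exp (Complex.I * (M : ℂ) * (ψ : ℂ)) - Complex.exp (Complex.I * (M : ℂ) * (θ : ℂ))) ^ 2 /
    (Complex.exp (Complex.I * (ψ : ℂ)) - Complex.exp (Complex.I * (θ : ℂ)))

end

open scoped Polynomial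

noncomputable section

open MeasureTheory

/-! The form ω(e^{iθ}) is decomposable: its coefficients are the maximal minors of the matrix of
Taylor coefficients of the p_n at e^{iθ}, so by Cauchy–Binet it is the wedge of L jet vectors
(`wronskianForm_eq_ιMulti`). Hence ω(e^{iθ_1}) ∧ ⋯ ∧ ω(e^{iθ_N}) is the volume form times a
confluent Vandermonde determinant, namely Δ^{L²} with Δ = ∏_{m<n} (e^{iθ_n} - e^{iθ_m}), whatever
the monic family (`volumeCoeff_prod_wronskianForm`). The density shares out half phases among the
pairs of angles and turns Δ^β into ∏ (2 sin((θ_n - θ_m)/2))^β. This is |Δ|^β for even β, and |Δ|^β ∏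
sgn(θ_n - θ_m) for odd β.

For even L², Fubini identifies the N-th power of the single integral with N! C_N.

For odd L², powers of the double integral carry the weight ∏ sgn(θ_{2j} - θ_{2j-1})/2. As Δ^{L²} is
antisymmetric, the weight may be antisymmetrized, which gives ⌊N/2⌋! ∏_{m<n} sgn(θ_n - θ_m)
(`sum_sign_mul_pairWeight_signKernel`); this is the missing sign. For odd N the border ε' can enter
only once, and supplies the unpaired factor.

For β = L² + 1, the kernel is a sum of antisymmetrized monomials, so the double form is ∑_j
W_{M-1-j} ∧ W_{M+j} in the moments W_k = ∫ ω(e^{iθ}) e^{ikθ} dμ. Its M-th power is M! W_0 ∧ ⋯ ∧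
W_{2M-1}, and antisymmetrizing ∏_k e^{ikθ_k} produces one more factor Δ. -/

/-! ### The confluent Vandermonde determinant -/

open Polynomial in
-- The change of basis from monomials is unitriangular. Any two monic families therefore give the
-- same determinant, and the Newton basis may replace p.
theorem det_functional_of_monic {n : ℕ} (p : Fin n → ℂ[X]) (hp : IsCompleteMonic p)
    (f : Fin n → ℂ[X] →ₗ[ℂ] ℂ) :
    (Matrix.of fun i j => f j (p i)).det =
      (Matrix.of fun i j : Fin n => f j (X ^ (i : ℕ))).det := by
  have h : (Matrix.of fun i j => f j (p i)) =
      (Matrix.of fun i j : Fin n => (p j).coeff i).transpose *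
        (Matrix.of fun i j : Fin n => f j (X ^ (i : ℕ))) := by
    ext i j
    have hi : p i = ∑ k : Fin n, (p i).coeff k • X ^ (k : ℕ) := by
      conv_lhs => rw [(p i).as_sum_range' n (by rw [(hp i).2]; exact i.2)]
      rw [Finset.sum_range]
      simp [Polynomial.smul_X_eq_monomial]
    simp only [Matrix.of_apply, Matrix.mul_apply, Matrix.transpose_apply]
    conv_lhs => rw [hi]
    simp [map_sum]
  rw [h, Matrix.det_mul, Matrix.det_transpose,
    Matrix.det_matrixOfPolynomials p (fun i => (hp i).2) (fun i => (hp i).1), one_mul]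

open Polynomial in
/-- The Newton basis for Hermite interpolation at the nodes `x`, each of multiplicity `L`. -/
def hermiteNewton {N : ℕ} (L : ℕ) (x : Fin N → ℂ) (a : Fin (N * L)) : ℂ[X] :=
  (∏ i ∈ Finset.Iio a.divNat, (X - C (x i)) ^ L) * (X - C (x a.divNat)) ^ (a.modNat : ℕ)

theorem hermiteNewton_isCompleteMonic {N : ℕ} (L : ℕ) (x : Fin N → ℂ) :
    IsCompleteMonic (hermiteNewton L x) := by
  intro a
  have h1 : (∏ i ∈ Finset.Iio a.divNat, (Polynomial.X - Polynomial.C (x i)) ^ L).Monic :=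
    Polynomial.monic_prod_of_monic _ _ fun i _ => (Polynomial.monic_X_sub_C _).pow _
  have h2 := (Polynomial.monic_X_sub_C (x a.divNat)).pow (a.modNat : ℕ)
  refine ⟨h1.mul h2, ?_⟩
  rw [hermiteNewton, h1.natDegree_mul h2, Polynomial.natDegree_prod_of_monic _ _
    fun i _ => (Polynomial.monic_X_sub_C _).pow _]
  simp only [Polynomial.natDegree_pow, Polynomial.natDegree_X_sub_C, mul_one, Finset.sum_const,
    Fin.card_Iio, smul_eq_mul]
  simp only [Fin.coe_divNat, Fin.coe_modNat]
  exact Nat.div_add_mod' _ _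

theorem prod_divNat {M : Type*} [CommMonoid M] {N L : ℕ} (g : Fin N → M) :
    ∏ a : Fin (N * L), g a.divNat = ∏ j, g j ^ L := by
  rw [← finProdFinEquiv.prod_comp, Fintype.prod_prod_type]
  refine Finset.prod_congr rfl fun j _ => ?_
  have h : ∀ l : Fin L, (finProdFinEquiv (j, l)).divNat = j := fun l =>
    congrArg Prod.fst (finProdFinEquiv.symm_apply_apply (j, l))
  simp [h]

/-- A Newton polynomial vanishes to order L at every earlier node and to order `a.modNat` at its
own, so the matrix is triangular. Each diagonal value ∏_{i<j} (x_j - x_i)^L occurs L times, whence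
the exponent L². -/
theorem det_hermiteNewton {N L : ℕ} (x : Fin N → ℂ) :
    (Matrix.of fun a b : Fin (N * L) =>
      (Polynomial.taylor (x b.divNat) (hermiteNewton L x a)).coeff b.modNat).det =
      (∏ m, ∏ n ∈ Finset.Ioi m, (x n - x m)) ^ (L ^ 2) := by
  rw [Matrix.det_of_isUpperTriangular]
  · have hd : ∀ a : Fin (N * L),
        (Polynomial.taylor (x a.divNat) (hermiteNewton L x a)).coeff a.modNat =
          ∏ i ∈ Finset.Iio a.divNat, (x a.divNat - x i) ^ L := by
      intro a
      rw [hermiteNewton, Polynomial.taylor_mul, Polynomial.taylor_pow, map_sub,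
        Polynomial.taylor_X, Polynomial.taylor_C, add_sub_cancel_right,
        Polynomial.coeff_mul_X_pow', if_pos le_rfl, Nat.sub_self, Polynomial.taylor_coeff_zero]
      simp [Polynomial.eval_prod]
    simp only [Matrix.of_apply, hd]
    rw [prod_divNat (fun j => ∏ i ∈ Finset.Iio j, (x j - x i) ^ L)]
    simp only [Finset.prod_pow, ← pow_mul, ← sq]
    congr 1
    exact Finset.prod_comm' (by simp)
  · intro a b hab
    simp only [id] at hab
    simp only [Matrix.of_apply, hermiteNewton, Polynomial.taylor_mul, Polynomial.taylor_pow]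
    have hdiv : b.divNat ≤ a.divNat := by
      simp only [Fin.le_def, Fin.coe_divNat]
      exact Nat.div_le_div_right hab.le
    rcases hdiv.lt_or_eq with h | h
    · have hdvd : Polynomial.X ^ L ∣ Polynomial.taylor (x b.divNat)
          (∏ i ∈ Finset.Iio a.divNat, (Polynomial.X - Polynomial.C (x i)) ^ L) := by
        rw [← Finset.mul_prod_erase _ _ (Finset.mem_Iio.2 h), Polynomial.taylor_mul,
          Polynomial.taylor_pow, map_sub, Polynomial.taylor_X, Polynomial.taylor_C,
          add_sub_cancel_right]
        exact dvd_mul_right _ _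
      exact Polynomial.X_pow_dvd_iff.1 (hdvd.mul_right _) _ b.modNat.2
    · have hm : (b.modNat : ℕ) < a.modNat := by
        have h' := congrArg Fin.val h
        simp only [Fin.coe_divNat, Fin.coe_modNat] at h' ⊢
        have := Nat.div_add_mod' (a : ℕ) L
        have := Nat.div_add_mod' (b : ℕ) L
        have hab' : (b : ℕ) < a := hab
        rw [h'] at this
        omega
      rw [h, map_sub, Polynomial.taylor_X, Polynomial.taylor_C, add_sub_cancel_right,
        Polynomial.coeff_mul_X_pow', if_neg (by omega)]

/-- The confluent Vandermonde determinant, with `L` derivatives at each node. -/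
theorem det_taylor_coeff {N L : ℕ} (x : Fin N → ℂ) (p : Fin (N * L) → ℂ[X])
    (hp : IsCompleteMonic p) :
    (Matrix.of fun a b : Fin (N * L) =>
      (Polynomial.taylor (x b.divNat) (p a)).coeff b.modNat).det =
      (∏ m, ∏ n ∈ Finset.Ioi m, (x n - x m)) ^ (L ^ 2) := by
  let f : Fin (N * L) → ℂ[X] →ₗ[ℂ] ℂ := fun b =>
    (Polynomial.lcoeff ℂ b.modNat).comp (Polynomial.taylor (x b.divNat))
  have h1 := det_functional_of_monic p hp f
  have h2 := det_functional_of_monic _ (hermiteNewton_isCompleteMonic L x) f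
  exact h1.trans (h2.symm.trans (det_hermiteNewton x))

/-! ### Decomposability of ω and the wedge of its values -/

/-- An increasing map is determined by its range, so if u ≠ t some u(i) lies outside the range of t
and gives a zero column. -/
theorem det_single_orderEmbedding {n L : ℕ} (t u : Fin L ↪o Fin n) :
    (Matrix.of fun l i : Fin L => (Pi.single (t l) 1 : Fin n → ℂ) (u i)).det =
      if u = t then 1 else 0 := by
  split_ifs with h
  · subst h
    convert Matrix.det_one (n := Fin L) (R := ℂ) with
    ext l i
    simp [Pi.single_apply, Matrix.one_apply, eq_comm]
  · obtain ⟨i, hi⟩ : ∃ i, u i ∉ Set.range t := by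
      by_contra hc
      push Not at hc
      have hsub : Finset.univ.image u ⊆ Finset.univ.image t := by
        intro a ha
        obtain ⟨i, -, rfl⟩ := Finset.mem_image.1 ha
        obtain ⟨j, hj⟩ := hc i
        exact Finset.mem_image.2 ⟨j, Finset.mem_univ _, hj⟩
      have heq := Finset.eq_of_subset_of_card_le hsub (by
        rw [Finset.card_image_of_injective _ u.injective,
          Finset.card_image_of_injective _ t.injective])
      have hr : Set.range u = Set.range t := by
        have := congrArg (fun s : Finset (Fin n) => (s : Set (Fin n))) heq
        simpa using this
      exact h (DFunLike.coe_injective ((u.strictMono.range_inj t.strictMono).1 hr))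
    refine Matrix.det_eq_zero_of_column_eq_zero i fun l => ?_
    rw [Matrix.of_apply, Pi.single_eq_of_ne]
    exact fun hl => hi ⟨l, hl.symm⟩

/-- The Cauchy–Binet expansion of a decomposable form. -/
theorem ιMulti_eq_sum_wedgeBasis {n L : ℕ} (v : Fin L → Fin n → ℂ) :
    ExteriorAlgebra.ιMulti ℂ L v =
      ∑ t : Fin L ↪o Fin n, (Matrix.of fun l i : Fin L => v l (t i)).det • wedgeBasis t := by
  let g : (Fin n → ℂ) [⋀^Fin L]→ₗ[ℂ] ExteriorAlgebra ℂ (Fin n → ℂ) :=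
    ∑ t : Fin L ↪o Fin n, (LinearMap.toSpanSingleton ℂ _ (wedgeBasis t)).compAlternatingMap
      ((Matrix.detRowAlternating (n := Fin L) (R := ℂ)).compLinearMap
        (LinearMap.funLeft ℂ ℂ t))
  have hg : ∀ v, g v =
      ∑ t : Fin L ↪o Fin n, (Matrix.of fun l i : Fin L => v l (t i)).det • wedgeBasis t := by
    intro v
    let ev : ((Fin n → ℂ) [⋀^Fin L]→ₗ[ℂ] ExteriorAlgebra ℂ (Fin n → ℂ)) →+
        ExteriorAlgebra ℂ (Fin n → ℂ) := ⟨⟨fun f => f v, rfl⟩, fun _ _ => rfl⟩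
    exact map_sum ev _ _
  have h : ExteriorAlgebra.ιMulti ℂ L = g := by
    -- Alternating maps are compared on distinct basis vectors. Sorting these costs the same sign on
    -- both sides and leaves an increasing family, for which one minor survives.
    refine Module.Basis.ext_alternating (Pi.basisFun ℂ (Fin n)) fun f hf => ?_
    have hs : StrictMono (f ∘ Tuple.sort f) :=
      (Tuple.monotone_sort f).strictMono_of_injective (hf.comp (Tuple.sort f).injective)
    let t : Fin L ↪o Fin n := OrderEmbedding.ofStrictMono _ hs
    have hft : (fun i => (Pi.basisFun ℂ (Fin n)) (f i)) =
        (fun l => (Pi.single (t l) 1 : Fin n → ℂ)) ∘ (Tuple.sort f).symm := by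
      funext l
      simp [t]
    rw [hft, AlternatingMap.map_perm, AlternatingMap.map_perm, hg]
    simp only [det_single_orderEmbedding]
    simp [wedgeBasis]
  rw [h, hg]

/-- The vector of `l`-th Taylor coefficients at `x` of a family of polynomials. -/
def jetVector {n : ℕ} (p : Fin n → ℂ[X]) (x : ℂ) (l : ℕ) : Fin n → ℂ :=
  fun a => (Polynomial.taylor x (p a)).coeff l

theorem wronskian_eq_det_taylor {L : ℕ} (q : Fin L → ℂ[X]) (x : ℂ) :
    wronskian q x = (Matrix.of fun n l : Fin L => (Polynomial.taylor x (q n)).coeff l).det := by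
  rw [wronskian]
  congr 2
  ext n l
  rw [Polynomial.taylor_coeff, ← Polynomial.factorial_smul_hasseDeriv]
  have : ((l : ℕ).factorial : ℂ) ≠ 0 := by exact_mod_cast (Nat.factorial_pos _).ne'
  rw [LinearMap.smul_apply, Polynomial.eval_smul, nsmul_eq_mul, one_div, inv_mul_cancel_left₀ this]

/-- The form `ω(e^{iθ})`. -/
def wronskianForm {n L : ℕ} (p : Fin n → ℂ[X]) (θ : ℝ) : ExteriorAlgebra ℂ (Fin n → ℂ) :=
  ∑ t : Fin L ↪o Fin n, wronskianAt p t θ • wedgeBasis t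

/-- The normalization 1/ℓ! makes each Wronskian a maximal minor of the jet matrix, so Cauchy–Binet
applies. -/
theorem wronskianForm_eq_ιMulti {n L : ℕ} (p : Fin n → ℂ[X]) (θ : ℝ) :
    wronskianForm (L := L) p θ = ExteriorAlgebra.ιMulti ℂ L
      (fun l => jetVector p (Complex.exp (Complex.I * (θ : ℂ))) l) := by
  rw [ιMulti_eq_sum_wedgeBasis, wronskianForm]
  refine Finset.sum_congr rfl fun t _ => ?_
  rw [wronskianAt, wronskian_eq_det_taylor, ← Matrix.det_transpose]
  rfl

theorem prod_ofFn_ιMulti {V : Type*} [AddCommGroup V] [Module ℂ V] {N L : ℕ}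
    (v : Fin N → Fin L → V) :
    (List.ofFn fun j => ExteriorAlgebra.ιMulti ℂ L (v j)).prod =
      ExteriorAlgebra.ιMulti ℂ (N * L) (fun a => v a.divNat a.modNat) := by
  rw [ExteriorAlgebra.ιMulti_apply, List.ofFn_mul, List.prod_flatten, List.map_ofFn]
  congr 2
  funext j
  rw [ExteriorAlgebra.ιMulti_apply, Function.comp_apply]
  congr 2
  funext l
  have h := finProdFinEquiv.symm_apply_apply (j, l)
  have h1 := congrArg Prod.fst h
  have h2 := congrArg Prod.snd h
  simp only [finProdFinEquiv_symm_apply] at h1 h2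
  have e : finProdFinEquiv (j, l) = ⟨(j : ℕ) * L + l, by
      calc (j : ℕ) * L + l < (j + 1) * L := by rw [add_mul, one_mul]; omega
        _ ≤ N * L := Nat.mul_le_mul_right _ j.2⟩ := by
    ext; simp [finProdFinEquiv, add_comm, mul_comm]
  rw [← e, h1, h2]

theorem volumeCoeff_prod_wronskianForm {N L : ℕ} (p : Fin (N * L) → ℂ[X])
    (hp : IsCompleteMonic p) (θ : Fin N → ℝ) :
    volumeCoeff (N * L) (List.ofFn fun j => wronskianForm (L := L) p (θ j)).prod =
      (∏ m, ∏ n ∈ Finset.Ioi m, (Complex.exp (Complex.I * (θ n : ℂ)) -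
        Complex.exp (Complex.I * (θ m : ℂ)))) ^ (L ^ 2) := by
  simp only [wronskianForm_eq_ιMulti]
  rw [prod_ofFn_ιMulti (fun (j : Fin N) (l : Fin L) =>
    jetVector p (Complex.exp (Complex.I * (θ j : ℂ))) l), volumeCoeff_ιMulti,
    ← det_taylor_coeff (fun j => Complex.exp (Complex.I * (θ j : ℂ))) p hp,
    Module.Basis.det_apply]
  congr 1

/-! ### Graded commutativity and the bordered hyperpfaffian -/

theorem ι_mul_ιMulti_comm {V : Type*} [AddCommGroup V] [Module ℂ V] (w : V) {n : ℕ}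
    (b : Fin n → V) :
    ExteriorAlgebra.ι ℂ w * ExteriorAlgebra.ιMulti ℂ n b =
      (-1 : ℂ) ^ n • (ExteriorAlgebra.ιMulti ℂ n b * ExteriorAlgebra.ι ℂ w) := by
  induction n with
  | zero => simp
  | succ n ih =>
    rw [ExteriorAlgebra.ιMulti_succ_apply, ← mul_assoc,
      eq_neg_of_add_eq_zero_left (ExteriorAlgebra.ι_add_mul_swap w (b 0)), neg_mul, mul_assoc, ih,
      mul_smul_comm, ← smul_neg, pow_succ, mul_smul, neg_smul, one_smul, mul_assoc]

theorem ιMulti_mul_ιMulti_comm {V : Type*} [AddCommGroup V] [Module ℂ V] {m n : ℕ}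
    (a : Fin m → V) (b : Fin n → V) :
    ExteriorAlgebra.ιMulti ℂ m a * ExteriorAlgebra.ιMulti ℂ n b =
      (-1 : ℂ) ^ (m * n) •
        (ExteriorAlgebra.ιMulti ℂ n b * ExteriorAlgebra.ιMulti ℂ m a) := by
  induction m with
  | zero => simp
  | succ m ih =>
    rw [ExteriorAlgebra.ιMulti_succ_apply, mul_assoc, ih, mul_smul_comm, ← mul_assoc,
      ι_mul_ιMulti_comm, smul_mul_assoc, smul_smul, ← pow_add, mul_assoc, Nat.succ_mul]

/-- Graded commutativity of the exterior algebra. -/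
theorem exteriorPower_mul_comm {V : Type*} [AddCommGroup V] [Module ℂ V] {m n : ℕ}
    {x y : ExteriorAlgebra ℂ V} (hx : x ∈ ⋀[ℂ]^m V) (hy : y ∈ ⋀[ℂ]^n V) :
    x * y = (-1 : ℂ) ^ (m * n) • (y * x) := by
  rw [← ExteriorAlgebra.ιMulti_span_fixedDegree] at hx hy
  induction hx, hy using Submodule.span_induction₂ with
  | mem_mem x y hx hy =>
    obtain ⟨a, rfl⟩ := hx
    obtain ⟨b, rfl⟩ := hy
    exact ιMulti_mul_ιMulti_comm a b
  | zero_left => simp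
  | zero_right => simp
  | add_left x y z _ _ _ h1 h2 => rw [add_mul, h1, h2, mul_add, smul_add]
  | add_right x y z _ _ _ h1 h2 => rw [mul_add, h1, h2, add_mul, smul_add]
  | smul_left r x y _ _ h => rw [smul_mul_assoc, h, mul_smul_comm, smul_comm]
  | smul_right r x y _ _ h => rw [mul_smul_comm, h, smul_mul_assoc, smul_comm]

theorem exteriorPower_mul_anticomm {V : Type*} [AddCommGroup V] [Module ℂ V] {m n : ℕ}
    (hm : Odd m) (hn : Odd n) {x y : ExteriorAlgebra ℂ V} (hx : x ∈ ⋀[ℂ]^m V)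
    (hy : y ∈ ⋀[ℂ]^n V) : x * y = -(y * x) := by
  rw [exteriorPower_mul_comm hx hy, (hm.mul hn).neg_one_pow, neg_one_smul]

theorem exteriorPower_commute {V : Type*} [AddCommGroup V] [Module ℂ V] {m n : ℕ}
    (hm : Even m) {x y : ExteriorAlgebra ℂ V} (hx : x ∈ ⋀[ℂ]^m V)
    (hy : y ∈ ⋀[ℂ]^n V) : Commute x y := by
  rw [Commute, SemiconjBy, exteriorPower_mul_comm hx hy, (hm.mul_right n).neg_one_pow, one_smul]

theorem exteriorPower_mul_self {V : Type*} [AddCommGroup V] [Module ℂ V] {m : ℕ}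
    (hm : Odd m) {x : ExteriorAlgebra ℂ V} (hx : x ∈ ⋀[ℂ]^m V) : x * x = 0 := by
  have h := exteriorPower_mul_anticomm hm hm hx hx
  have h2 : (2 : ℂ) • (x * x) = 0 := by
    rw [two_smul]
    nth_rewrite 1 [h]
    exact neg_add_cancel _
  exact (smul_eq_zero.1 h2).resolve_left two_ne_zero

theorem eq_zero_of_mem_exteriorPower {n d : ℕ} (h : n < d) {x : ExteriorAlgebra ℂ (Fin n → ℂ)}
    (hx : x ∈ ⋀[ℂ]^d (Fin n → ℂ)) : x = 0 := by
  have h0 : ExteriorAlgebra.ιMulti ℂ d (M := Fin n → ℂ) = 0 := by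
    refine Module.Basis.ext_alternating (Pi.basisFun ℂ (Fin n)) fun f hf => ?_
    have := Fintype.card_le_of_injective f hf
    simp only [Fintype.card_fin] at this
    omega
  rw [← ExteriorAlgebra.ιMulti_span_fixedDegree] at hx
  have hle : Submodule.span ℂ (Set.range (ExteriorAlgebra.ιMulti ℂ d (M := Fin n → ℂ))) ≤ ⊥ :=
    Submodule.span_le.2 (by rintro _ ⟨v, rfl⟩; simp [h0])
  exact (Submodule.mem_bot ℂ).1 (hle hx)

theorem ιMulti_mem {V : Type*} [AddCommGroup V] [Module ℂ V] {n : ℕ} (v : Fin n → V) :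
    ExteriorAlgebra.ιMulti ℂ n v ∈ ⋀[ℂ]^n V :=
  ExteriorAlgebra.ιMulti_range ℂ n ⟨v, rfl⟩

theorem wedgeBasis_mem {n L : ℕ} (t : Fin L → Fin n) : wedgeBasis t ∈ ⋀[ℂ]^L (Fin n → ℂ) :=
  ιMulti_mem _

theorem singleForm_mem (N L β : ℕ) (p : Fin (N * L) → ℂ[X]) :
    singleForm N L β p ∈ ⋀[ℂ]^L (Fin (N * L) → ℂ) :=
  Submodule.sum_mem _ fun t _ => Submodule.smul_mem _ _ (wedgeBasis_mem t)

theorem doubleForm_mem (N L β : ℕ) (p : Fin (N * L) → ℂ[X]) (κ : ℝ → ℝ → ℂ) :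
    doubleForm N L β p κ ∈ ⋀[ℂ]^(L + L) (Fin (N * L) → ℂ) :=
  Submodule.sum_mem _ fun t _ => Submodule.sum_mem _ fun u _ => Submodule.smul_mem _ _
    (SetLike.mul_mem_graded (wedgeBasis_mem t) (wedgeBasis_mem u))

theorem map_mem_exteriorPower {V W : Type*} [AddCommGroup V] [Module ℂ V] [AddCommGroup W]
    [Module ℂ W] (f : V →ₗ[ℂ] W) {n : ℕ} {x : ExteriorAlgebra ℂ V} (hx : x ∈ ⋀[ℂ]^n V) :
    ExteriorAlgebra.map f x ∈ ⋀[ℂ]^n W := by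
  rw [← ExteriorAlgebra.ιMulti_span_fixedDegree] at hx
  induction hx using Submodule.span_induction with
  | mem x hx =>
    obtain ⟨v, rfl⟩ := hx
    rw [ExteriorAlgebra.map_apply_ιMulti]
    exact ιMulti_mem _
  | zero => simp
  | add x y _ _ hx hy => rw [map_add]; exact Submodule.add_mem _ hx hy
  | smul a x _ hx => rw [map_smul]; exact Submodule.smul_mem _ _ hx

theorem ιMulti_cast {V : Type*} [AddCommGroup V] [Module ℂ V] {m n : ℕ} (h : m = n)
    (v : Fin n → V) :
    ExteriorAlgebra.ιMulti ℂ m (v ∘ Fin.cast h) = ExteriorAlgebra.ιMulti ℂ n v := by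
  subst h
  rfl

theorem extendForm_volumeForm_mul_borderForm (N L : ℕ) :
    extendForm N L (volumeForm (N * L)) * borderForm N L = volumeForm ((N + 1) * L) := by
  rw [extendForm, volumeForm, wedgeBasis, ExteriorAlgebra.map_apply_ιMulti, borderForm, wedgeBasis,
    ExteriorAlgebra.ιMulti_mul_ιMulti, volumeForm, wedgeBasis,
    ← ιMulti_cast (Nat.succ_mul N L).symm]
  congr 1
  funext i
  refine Fin.addCases (fun i => ?_) (fun i => ?_) i
  · rw [Fin.append_left, Function.comp_apply, ← Pi.basisFun_apply, Module.Basis.constr_basis]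
    rfl
  · rw [Fin.append_right]
    rfl

/-- The binomial theorem, cut off after the term linear in b. -/
theorem add_pow_of_commute_of_mul_self {R : Type*} [Ring R] {a b : R} (h : Commute a b)
    (hb : b * b = 0) (n : ℕ) : (a + b) ^ (n + 1) = a ^ (n + 1) + (n + 1 : ℕ) • (a ^ n * b) := by
  induction n with
  | zero => simp
  | succ n ih =>
    have h1 : a ^ n * b * a = a ^ (n + 1) * b := by
      rw [mul_assoc, ← h.eq, ← mul_assoc, ← pow_succ]
    have h2 : a ^ n * b * b = 0 := by rw [mul_assoc, hb, mul_zero]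
    rw [pow_succ, ih, mul_add, add_mul, add_mul, smul_mul_assoc, smul_mul_assoc, h1, h2, smul_zero,
      add_zero, ← pow_succ, add_assoc, succ_nsmul _ (n + 1)]

/-- The hyperpfaffian of a bordered form. -/
theorem hyperpfaffian_bordered {N L K : ℕ} (hL : Odd L) (hN : N = 2 * K + 1)
    {A S : ExteriorAlgebra ℂ (Fin (N * L) → ℂ)} (hA : A ∈ ⋀[ℂ]^(L + L) (Fin (N * L) → ℂ))
    (hS : S ∈ ⋀[ℂ]^L (Fin (N * L) → ℂ)) :
    hyperpfaffian (K + 1) (extendForm N L A + extendForm N L S * borderForm N L) =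
      (1 / (K.factorial : ℂ)) * volumeCoeff (N * L) (A ^ K * S) := by
  have hA' : extendForm N L A ∈ ⋀[ℂ]^(L + L) (Fin ((N + 1) * L) → ℂ) := map_mem_exteriorPower _ hA
  have hS' : extendForm N L S ∈ ⋀[ℂ]^L (Fin ((N + 1) * L) → ℂ) := map_mem_exteriorPower _ hS
  have hE : borderForm N L ∈ ⋀[ℂ]^L (Fin ((N + 1) * L) → ℂ) := wedgeBasis_mem _
  have hB := SetLike.mul_mem_graded hS' hE
  have hcomm := exteriorPower_commute (Even.add_self L) hA' hB
  have hBB : extendForm N L S * borderForm N L * (extendForm N L S * borderForm N L) = 0 := by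
    rw [mul_assoc, ← mul_assoc (borderForm N L), exteriorPower_mul_anticomm hL hL hE hS', neg_mul,
      mul_assoc, exteriorPower_mul_self hL hE, mul_zero, neg_zero, mul_zero]
  -- The degree 2L(K + 1) = (N + 1)L exceeds NL. Only the term with exactly one border factor
  -- survives.
  have hAK : A ^ (K + 1) = 0 := by
    have h := SetLike.pow_mem_graded (K + 1) hA
    refine eq_zero_of_mem_exteriorPower ?_ h
    rw [smul_eq_mul, hN]
    have := hL.pos
    nlinarith
  have hmem : A ^ K * S ∈ ⋀[ℂ]^(N * L) (Fin (N * L) → ℂ) := by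
    have h := SetLike.mul_mem_graded (SetLike.pow_mem_graded K hA) hS
    have e : K • (L + L) + L = N * L := by rw [smul_eq_mul, hN]; ring
    rwa [e] at h
  have hvol : volumeCoeff ((N + 1) * L) (volumeForm ((N + 1) * L)) = 1 := by
    rw [volumeForm, wedgeBasis, volumeCoeff_ιMulti]
    convert (Pi.basisFun ℂ (Fin ((N + 1) * L))).det_self using 2
    funext i
    simp
  have hprod : extendForm N L A ^ K * (extendForm N L S * borderForm N L) =
      volumeCoeff (N * L) (A ^ K * S) • volumeForm ((N + 1) * L) := by
    rw [← mul_assoc, ← map_pow, ← map_mul, eq_volumeCoeff_smul _ hmem, map_smul, smul_mul_assoc,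
      extendForm_volumeForm_mul_borderForm, ← eq_volumeCoeff_smul _ hmem]
  rw [hyperpfaffian, add_pow_of_commute_of_mul_self hcomm hBB, ← map_pow, hAK, map_zero, zero_add,
    hprod, map_smul, ← Nat.cast_smul_eq_nsmul ℂ, map_smul, map_smul, hvol, Nat.factorial_succ]
  have h1 : ((K + 1 : ℕ) : ℂ) ≠ 0 := by exact_mod_cast Nat.succ_ne_zero K
  have h2 : (K.factorial : ℂ) ≠ 0 := by exact_mod_cast (Nat.factorial_pos _).ne'
  push_cast at h1 ⊢
  simp only [smul_eq_mul, mul_one]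
  field_simp

/-! ### Expansion of powers of forms over words -/

/-- `A ^ (n / 2) * S ^ (n % 2)`. -/
def pairForm {R : Type*} [Ring R] (A S : R) : ℕ → R
  | 0 => 1
  | 1 => S
  | n + 2 => A * pairForm A S n

theorem pairForm_even {R : Type*} [Ring R] (A S : R) (M : ℕ) : pairForm A S (2 * M) = A ^ M := by
  induction M with
  | zero => simp [pairForm]
  | succ M ih => rw [Nat.mul_succ, pairForm, ih, pow_succ']

theorem pairForm_odd {R : Type*} [Ring R] (A S : R) (M : ℕ) :
    pairForm A S (2 * M + 1) = A ^ M * S := by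
  induction M with
  | zero => simp [pairForm]
  | succ M ih =>
    rw [show 2 * (M + 1) + 1 = 2 * M + 1 + 2 by ring, pairForm, ih, pow_succ', mul_assoc]

/-- `c (τ 0) (τ 1) * c (τ 2) (τ 3) * ⋯`, with a last factor `s` if the number of indices is odd. -/
def pairWeight {ι : Type*} (c : ι → ι → ℂ) (s : ι → ℂ) : (n : ℕ) → (Fin n → ι) → ℂ
  | 0, _ => 1
  | 1, τ => s (τ 0)
  | n + 2, τ => c (τ 0) (τ 1) * pairWeight c s n (fun i => τ i.succ.succ)

theorem pairWeight_comp {ι κ : Type*} (c : ι → ι → ℂ) (s : ι → ℂ) (f : κ → ι) :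
    ∀ (n : ℕ) (τ : Fin n → κ), pairWeight c s n (f ∘ τ) =
      pairWeight (fun i j => c (f i) (f j)) (fun i => s (f i)) n τ
  | 0, _ => rfl
  | 1, _ => rfl
  | n + 2, τ => congrArg (c (f (τ 0)) (f (τ 1)) * ·)
      (pairWeight_comp c s f n (fun i => τ i.succ.succ))

theorem sum_fin_succ_fun {ι M : Type*} [Fintype ι] [AddCommMonoid M] {n : ℕ}
    (g : (Fin (n + 1) → ι) → M) :
    ∑ τ, g τ = ∑ t : ι, ∑ τ : Fin n → ι, g (Fin.cons t τ) := by
  rw [← (Fin.consEquiv (fun _ : Fin (n + 1) => ι)).sum_comp, Fintype.sum_prod_type]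
  rfl

/-- Each new factor is multiplied on the left, so no commutation relation is needed. One recursion
serves both parities of the number of factors. -/
theorem pairForm_eq_sum {ι R : Type*} [Fintype ι] [Ring R] [Algebra ℂ R] (c : ι → ι → ℂ)
    (s : ι → ℂ) (e : ι → R) :
    ∀ n : ℕ, pairForm (∑ t, ∑ u, c t u • (e t * e u)) (∑ t, s t • e t) n =
      ∑ τ : Fin n → ι, pairWeight c s n τ • (List.ofFn fun i => e (τ i)).prod
  | 0 => by simp [pairForm, pairWeight]
  | 1 => by
    rw [sum_fin_succ_fun]
    simp [pairForm, pairWeight]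
  | n + 2 => by
    rw [pairForm, pairForm_eq_sum c s e n, sum_fin_succ_fun, Finset.sum_mul]
    refine Finset.sum_congr rfl fun t _ => ?_
    rw [sum_fin_succ_fun, Finset.sum_mul]
    refine Finset.sum_congr rfl fun u _ => ?_
    rw [Finset.mul_sum]
    refine Finset.sum_congr rfl fun τ _ => ?_
    simp only [pairWeight, List.ofFn_succ, List.prod_cons, Fin.cons_succ, Fin.cons_zero,
      smul_mul_smul_comm, mul_assoc]
    rfl

/-! ### The sign identity by Grassmann variables -/

section Grassmann

variable {R : Type*} [Ring R] (e : ℕ → R)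

/-- The quadratic element `∑_{i<j<n} e_i e_j`. -/
def grassmannQuad (n : ℕ) : R := ∑ j ∈ Finset.range n, (∑ i ∈ Finset.range j, e i) * e j

theorem commute_mul_of_anticomm {a b x : R} (ha : a * x = -(x * a)) (hb : b * x = -(x * b)) :
    Commute (a * b) x := by
  rw [Commute, SemiconjBy, mul_assoc, hb, mul_neg, ← mul_assoc, ha, neg_mul, neg_neg, mul_assoc]

theorem add_pow_mul_of_mul_eq_zero {a b s : R} (h : Commute a b) (hs : b * s = 0) (n : ℕ) :
    (a + b) ^ n * s = a ^ n * s := by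
  induction n with
  | zero => simp
  | succ n ih =>
    have hc : Commute (a + b) a := (Commute.refl a).add_left h.symm
    rw [pow_succ, mul_assoc, add_mul, hs, add_zero, ← mul_assoc, (hc.pow_left n).eq, mul_assoc, ih,
      ← mul_assoc, ← pow_succ']

variable {e}

/-- Write Q_n for the quadratic element, S_n = ∑_{i<n} e_i and E_n = e_0 ⋯ e_{n-1}. Then Q_{n+1} =
Q_n + S_n e_n, where the summands commute and the second squares to zero, so passing from n to n + 1
leaves two binomial terms. The parities alternate: the even claim for M gives the odd one, which
gives the even claim for M + 1. -/
theorem grassmannQuad_pow (anti : ∀ i j, e i * e j = -(e j * e i)) (hsq : ∀ i, e i * e i = 0)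
    (M : ℕ) :
    grassmannQuad e (2 * M) ^ M = M.factorial • (List.ofFn fun i : Fin (2 * M) => e i).prod ∧
    grassmannQuad e (2 * M + 1) ^ M * ∑ i ∈ Finset.range (2 * M + 1), e i =
      M.factorial • (List.ofFn fun i : Fin (2 * M + 1) => e i).prod := by
  set S : ℕ → R := fun n => ∑ i ∈ Finset.range n, e i with hS
  set E : ℕ → R := fun n => (List.ofFn fun i : Fin n => e i).prod with hE
  have hEs : ∀ n, E (n + 1) = E n * e n := fun n => by
    simp only [hE, List.ofFn_succ', List.concat_eq_append, List.prod_append]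
    simp
  have hQs : ∀ n, grassmannQuad e (n + 1) = grassmannQuad e n + S n * e n := fun n =>
    Finset.sum_range_succ _ _
  have hSe : ∀ n j, S n * e j = -(e j * S n) := fun n j => by
    simp only [hS, Finset.sum_mul, Finset.mul_sum, ← Finset.sum_neg_distrib]
    exact Finset.sum_congr rfl fun i _ => anti i j
  have hSS : ∀ n, S n * S n = 0 := fun n => by
    induction n with
    | zero => simp [hS]
    | succ n ih =>
      have : S (n + 1) = S n + e n := Finset.sum_range_succ _ _
      rw [this, add_mul, mul_add, mul_add, ih, hsq, hSe]
      simp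
  have hQe : ∀ n j, Commute (grassmannQuad e n) (e j) := fun n j =>
    Commute.sum_left _ _ _ fun k _ => commute_mul_of_anticomm (hSe k j) (anti k j)
  have hQS : ∀ n k, Commute (grassmannQuad e n) (S k) := fun n k =>
    Commute.sum_right _ _ _ fun j _ => hQe n j
  have hEe : ∀ n, ∀ j < n, E n * e j = 0 := fun n => by
    induction n with
    | zero => simp
    | succ n ih =>
      intro j hj
      rcases Nat.lt_succ_iff_lt_or_eq.1 hj with h | rfl
      · rw [hEs, mul_assoc, anti, mul_neg, ← mul_assoc, ih j h, zero_mul, neg_zero]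
      · rw [hEs, mul_assoc, hsq, mul_zero]
  have hES : ∀ n, ∀ j ≤ n, E n * S j = 0 := fun n j hj => by
    simp only [hS, Finset.mul_sum]
    exact Finset.sum_eq_zero fun i hi => hEe n i ((Finset.mem_range.1 hi).trans_le hj)
  have hEQ : ∀ n, E n * grassmannQuad e n = 0 := fun n => by
    rw [grassmannQuad, Finset.mul_sum]
    refine Finset.sum_eq_zero fun j hj => ?_
    rw [← mul_assoc, hES n j (Finset.mem_range.1 hj).le, zero_mul]
  have hcomm : ∀ n, Commute (grassmannQuad e n) (S n * e n) := fun n =>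
    (hQS n n).mul_right (hQe n n)
  have hSeS : ∀ n, S n * e n * S n = 0 := fun n => by
    rw [hSe, neg_mul, mul_assoc, hSS, mul_zero, neg_zero]
  have hodd : ∀ M, grassmannQuad e (2 * M) ^ M = M.factorial • E (2 * M) →
      grassmannQuad e (2 * M + 1) ^ M * S (2 * M + 1) = M.factorial • E (2 * M + 1) := by
    intro M h
    have hs : S (2 * M + 1) = S (2 * M) + e (2 * M) := Finset.sum_range_succ _ _
    rw [hQs, add_pow_mul_of_mul_eq_zero (hcomm _), h, hs, smul_mul_assoc, mul_add,
      hES _ _ le_rfl, zero_add, hEs]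
    rw [hs, mul_add, hSeS, mul_assoc, hsq, mul_zero, add_zero]
  have hbb : ∀ n, S n * e n * (S n * e n) = 0 := fun n => by
    rw [← mul_assoc, hSeS, zero_mul]
  suffices h : grassmannQuad e (2 * M) ^ M = M.factorial • E (2 * M) from ⟨h, hodd M h⟩
  induction M with
  | zero => simp [hE]
  | succ M ih =>
    have h1 := hodd M ih
    rw [Nat.mul_succ, show 2 * M + 2 = 2 * M + 1 + 1 from rfl, hQs,
      add_pow_of_commute_of_mul_self (hcomm _) (hbb _), ← mul_assoc, h1]
    -- Here Q_{2M+1}^{M+1} vanishes: its two terms contain E_{2M} Q_{2M} and E_{2M} S_{2M}, which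
    -- repeat a variable.
    rw [hQs, add_pow_of_commute_of_mul_self (hcomm _) (hbb _), pow_succ, ih, ← mul_assoc,
      smul_mul_assoc, hEQ, smul_mul_assoc (M.factorial) (E (2 * M)), hES _ _ le_rfl, smul_zero,
      zero_mul, smul_zero, zero_add, zero_add, smul_mul_assoc, ← hEs, smul_smul,
      Nat.factorial_succ]

end Grassmann

theorem signKernel_swap (x y : ℝ) : signKernel x y = -signKernel y x := by
  rw [signKernel, signKernel, ← neg_sub x y, Real.sign_neg, Complex.ofReal_neg]

theorem signKernel_of_lt {x y : ℝ} (h : x < y) : signKernel x y = 1 := by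
  rw [signKernel, Real.sign_of_pos (sub_pos.2 h), Complex.ofReal_one]

theorem signKernel_self (x : ℝ) : signKernel x x = 0 := by
  simp [signKernel]

/-- Both the sign and e_t e_u change sign under exchange, so the two orders of a pair contribute
equally and absorb the factor 1/2. -/
theorem sum_sign_smul_eq_grassmannQuad {R : Type*} [Ring R] [Algebra ℂ R] {e : ℕ → R}
    (anti : ∀ i j, e i * e j = -(e j * e i)) (n : ℕ) :
    ∑ t ∈ Finset.range n, ∑ u ∈ Finset.range n, (signKernel t u / 2) • (e t * e u) =
      grassmannQuad e n := by
  induction n with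
  | zero => simp [grassmannQuad]
  | succ n ih =>
    have hrow : ∀ t ∈ Finset.range n, (signKernel t n / 2) • (e t * e n) =
        (1 / 2 : ℂ) • (e t * e n) := fun t ht => by
      rw [signKernel_of_lt (by exact_mod_cast Finset.mem_range.1 ht)]
    have hcol : ∀ u ∈ Finset.range n, (signKernel n u / 2) • (e n * e u) =
        (1 / 2 : ℂ) • (e u * e n) := fun u hu => by
      rw [signKernel_swap, signKernel_of_lt (by exact_mod_cast Finset.mem_range.1 hu), anti n u,
        smul_neg, neg_div, neg_smul, neg_neg]
    simp only [Finset.sum_range_succ, Finset.sum_add_distrib]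
    rw [ih, Finset.sum_congr rfl hrow, Finset.sum_congr rfl hcol, signKernel_self, zero_div,
      zero_smul, add_zero, add_assoc, ← Finset.sum_add_distrib, grassmannQuad, grassmannQuad,
      Finset.sum_range_succ, Finset.sum_mul]
    simp only [← add_smul]
    norm_num

theorem sum_perm_eq_sum_fun_det {N : ℕ} (g : (Fin N → Fin N) → ℂ) :
    ∑ τ : Fin N → Fin N, g τ * (Pi.basisFun ℂ (Fin N)).det (fun i => Pi.single (τ i) 1) =
      ∑ σ : Equiv.Perm (Fin N), ((Equiv.Perm.sign σ : ℤ) : ℂ) * g σ := by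
  symm
  refine Fintype.sum_of_injective (fun σ : Equiv.Perm (Fin N) => (σ : Fin N → Fin N))
    DFunLike.coe_injective _ _ ?_ ?_
  · intro τ hτ
    have hni : ¬ Function.Injective τ := fun h =>
      hτ ⟨Equiv.ofBijective τ (Finite.injective_iff_bijective.1 h), rfl⟩
    rw [AlternatingMap.map_eq_zero_of_not_injective _ _ fun h => hni fun a b hab =>
      h (by simp only [hab]), mul_zero]
  · intro σ
    have h : (fun i => (Pi.single (σ i) 1 : Fin N → ℂ)) = (Pi.basisFun ℂ (Fin N)) ∘ σ := by
      funext i; simp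
    rw [h, AlternatingMap.map_perm, Module.Basis.det_self, mul_comm, Units.smul_def,
      zsmul_eq_mul, mul_one]

/-- Essentially, the Pfaffian of the sign matrix is 1. The volume coefficient of one product is
computed twice: by words, where only permutations survive, and by `grassmannQuad_pow`. -/
theorem sum_sign_mul_pairWeight_perm (N : ℕ) :
    ∑ σ : Equiv.Perm (Fin N), ((Equiv.Perm.sign σ : ℤ) : ℂ) *
      pairWeight (fun i j : Fin N => signKernel (i : ℕ) (j : ℕ) / 2) (fun _ => 1) N σ =
      ((N / 2).factorial : ℂ) := by
  -- Extension by zero, since the Grassmann variables are indexed by all of ℕ.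
  let v : ℕ → Fin N → ℂ := fun i => if h : i < N then Pi.single ⟨i, h⟩ 1 else 0
  let e : ℕ → ExteriorAlgebra ℂ (Fin N → ℂ) := fun i => ExteriorAlgebra.ι ℂ (v i)
  have anti : ∀ i j, e i * e j = -(e j * e i) := fun i j =>
    eq_neg_of_add_eq_zero_left (ExteriorAlgebra.ι_add_mul_swap _ _)
  have hsq : ∀ i, e i * e i = 0 := fun i => ExteriorAlgebra.ι_sq_zero _
  have hv : ∀ i : Fin N, v i = Pi.single i 1 := fun i => by simp [v]
  have hexp := pairForm_eq_sum (fun i j : Fin N => signKernel (i : ℕ) (j : ℕ) / 2) (fun _ => 1)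
    (fun i => e i) N
  have hQ : ∑ t : Fin N, ∑ u : Fin N, (signKernel (t : ℕ) (u : ℕ) / 2) • (e t * e u) =
      grassmannQuad e N := by
    rw [← sum_sign_smul_eq_grassmannQuad anti, Finset.sum_range]
    exact Finset.sum_congr rfl fun t _ =>
      (Finset.sum_range fun u : ℕ => (signKernel (t : ℕ) u / 2) • (e t * e u)).symm
  have hS : ∑ t : Fin N, (1 : ℂ) • e t = ∑ i ∈ Finset.range N, e i := by
    rw [Finset.sum_range]
    simp
  have hF : pairForm (grassmannQuad e N) (∑ i ∈ Finset.range N, e i) N =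
      (N / 2).factorial • (List.ofFn fun i : Fin N => e i).prod := by
    rcases Nat.even_or_odd' N with ⟨M, h | h⟩
    · have := (grassmannQuad_pow anti hsq M).1
      rw [← pairForm_even _ (∑ i ∈ Finset.range N, e i), ← h] at this
      rw [this, show N / 2 = M by omega]
    · have := (grassmannQuad_pow anti hsq M).2
      rw [← pairForm_odd, ← h] at this
      rw [this, show N / 2 = M by omega]
  rw [hQ, hS, hF] at hexp
  have hcoef := congrArg (volumeCoeff N) hexp
  have hdet : ∀ τ : Fin N → Fin N, volumeCoeff N (List.ofFn fun i => e (τ i)).prod =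
      (Pi.basisFun ℂ (Fin N)).det (fun i => Pi.single (τ i) 1) := fun τ => by
    rw [← volumeCoeff_ιMulti, ExteriorAlgebra.ιMulti_apply]
    simp only [e, hv]
  simp only [map_sum, map_smul, map_nsmul, smul_eq_mul, hdet] at hcoef
  rw [sum_perm_eq_sum_fun_det] at hcoef
  rw [← hcoef]
  have h1 : (fun i => (Pi.single i 1 : Fin N → ℂ)) = Pi.basisFun ℂ (Fin N) := by
    funext i; simp
  rw [h1, Module.Basis.det_self, nsmul_eq_mul, mul_one]

/-- The antisymmetrization of `∏ sgn(θ_{2j+1} - θ_{2j})` is a multiple of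
`∏_{m<n} sgn(θ_n - θ_m)`. -/
theorem sum_sign_mul_pairWeight_signKernel {N : ℕ} (θ : Fin N → ℝ) (hθ : Function.Injective θ) :
    ∑ σ : Equiv.Perm (Fin N), ((Equiv.Perm.sign σ : ℤ) : ℂ) *
      pairWeight (fun x y => signKernel x y / 2) (fun _ => 1) N (θ ∘ σ) =
      ((N / 2).factorial : ℂ) * ∏ m, ∏ n ∈ Finset.Ioi m, signKernel (θ m) (θ n) := by
  -- The signs depend only on the order of the angles, so sorting reduces to the angles 0, 1, …, N -
  -- 1. The product of all signs is then the sign of ρ, and reindexing the sum by σ ↦ ρσ produces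
  -- the same sign.
  set ρ := Tuple.sort θ with hρ
  set η : Fin N → ℝ := θ ∘ ρ with hη
  have hmono : StrictMono η :=
    (Tuple.monotone_sort θ).strictMono_of_injective (hθ.comp ρ.injective)
  have hker : ∀ i j : Fin N, signKernel (η i) (η j) = signKernel (i : ℕ) (j : ℕ) := by
    intro i j
    rcases lt_trichotomy i j with h | rfl | h
    · rw [signKernel_of_lt (hmono h), signKernel_of_lt (by exact_mod_cast h)]
    · rw [signKernel_self, signKernel_self]
    · rw [signKernel_swap, signKernel_of_lt (hmono h), signKernel_swap,
        signKernel_of_lt (by exact_mod_cast h)]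
  have hprod : ∏ m, ∏ n ∈ Finset.Ioi m, signKernel (θ m) (θ n) =
      ((Equiv.Perm.sign ρ : ℤ) : ℂ) := by
    have h1 := ρ.prod_Ioi_comp_eq_sign_mul_prod
      (f := fun m n => signKernel (θ m) (θ n)) (fun i j => signKernel_swap _ _)
    have h2 : ∏ m, ∏ n ∈ Finset.Ioi m, signKernel (θ (ρ m)) (θ (ρ n)) = 1 :=
      Finset.prod_eq_one fun m _ => Finset.prod_eq_one fun n hn =>
        signKernel_of_lt (hmono (Finset.mem_Ioi.1 hn))
    rw [h2] at h1
    have h3 : ((Equiv.Perm.sign ρ : ℤ) : ℂ) * ((Equiv.Perm.sign ρ : ℤ) : ℂ) = 1 := by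
      norm_cast
      simp
    linear_combination (-(Equiv.Perm.sign ρ : ℤ) : ℂ) * h1 +
      (-∏ m, ∏ n ∈ Finset.Ioi m, signKernel (θ m) (θ n)) * h3
  rw [hprod, ← sum_sign_mul_pairWeight_perm, Finset.sum_mul,
    ← (Equiv.sum_comp (Equiv.mulLeft ρ))]
  refine Finset.sum_congr rfl fun σ _ => ?_
  have hc : θ ∘ ((Equiv.mulLeft ρ) σ) = η ∘ σ := rfl
  rw [hc, pairWeight_comp]
  simp only [hker, Equiv.coe_mulLeft, Equiv.Perm.sign_mul, Units.val_mul, Int.cast_mul]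
  ring

/-! ### Bounded measurable functions -/

/-- Measurable functions with values in a bounded subset of `ℂ`. -/
def BoundedMeasurable {X : Type*} [MeasurableSpace X] (f : X → ℂ) : Prop :=
  Measurable f ∧ ∃ C, ∀ x, ‖f x‖ ≤ C

namespace BoundedMeasurable

variable {X Y : Type*} [MeasurableSpace X] [MeasurableSpace Y]

theorem const (c : ℂ) : BoundedMeasurable fun _ : X => c :=
  ⟨measurable_const, ‖c‖, fun _ => le_rfl⟩

theorem comp {f : X → ℂ} (hf : BoundedMeasurable f) {g : Y → X} (hg : Measurable g) :
    BoundedMeasurable fun y => f (g y) :=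
  ⟨hf.1.comp hg, hf.2.imp fun _ h y => h (g y)⟩

theorem mul {f g : X → ℂ} (hf : BoundedMeasurable f) (hg : BoundedMeasurable g) :
    BoundedMeasurable fun x => f x * g x := by
  obtain ⟨C, hC⟩ := hf.2
  obtain ⟨D, hD⟩ := hg.2
  refine ⟨hf.1.mul hg.1, C * D, fun x => ?_⟩
  rw [norm_mul]
  exact mul_le_mul (hC x) (hD x) (norm_nonneg _) ((norm_nonneg _).trans (hC x))

theorem add {f g : X → ℂ} (hf : BoundedMeasurable f) (hg : BoundedMeasurable g) :
    BoundedMeasurable fun x => f x + g x := by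
  obtain ⟨C, hC⟩ := hf.2
  obtain ⟨D, hD⟩ := hg.2
  exact ⟨hf.1.add hg.1, C + D, fun x => (norm_add_le _ _).trans (add_le_add (hC x) (hD x))⟩

theorem prod {α : Type*} (s : Finset α) {f : α → X → ℂ} (hf : ∀ i, BoundedMeasurable (f i)) :
    BoundedMeasurable fun x => ∏ i ∈ s, f i x := by
  classical
  induction s using Finset.induction_on with
  | empty => simpa using const 1
  | insert a s ha ih => simpa [Finset.prod_insert ha] using (hf a).mul ih

theorem integrable {f : X → ℂ} (hf : BoundedMeasurable f) (μ : Measure X) [IsFiniteMeasure μ] :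
    Integrable f μ :=
  hf.2.elim fun C hC =>
    Integrable.of_bound hf.1.aestronglyMeasurable C (Filter.Eventually.of_forall hC)

theorem pairWeight {κ : X → X → ℂ} (hκ : BoundedMeasurable fun z : X × X => κ z.1 z.2) :
    ∀ n : ℕ, BoundedMeasurable (pairWeight κ (fun _ => 1) n)
  | 0 => const 1
  | 1 => const 1
  | n + 2 =>
    (hκ.comp (g := fun θ : Fin (n + 2) → X => (θ 0, θ 1)) (by fun_prop)).mul
      ((pairWeight hκ n).comp (g := fun (θ : Fin (n + 2) → X) i => θ i.succ.succ) (by fun_prop))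

end BoundedMeasurable

/-! ### Fubini and antisymmetrization for a finite product measure -/

section Integration

variable {X : Type*} [MeasurableSpace X] (μ : Measure X) [IsFiniteMeasure μ]

theorem integral_fin_succ_fun {n : ℕ} {f : (Fin (n + 1) → X) → ℂ} (hf : BoundedMeasurable f) :
    ∫ θ, f θ ∂(Measure.pi fun _ => μ) =
      ∫ x, ∫ θ, f (Fin.cons x θ) ∂(Measure.pi fun _ : Fin n => μ) ∂μ := by
  have h := (measurePreserving_piFinSuccAbove (fun _ : Fin (n + 1) => μ) 0).symm
  rw [← h.integral_comp', integral_prod]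
  · simp [MeasurableEquiv.piFinSuccAbove, Fin.insertNthEquiv]
  · exact (hf.comp (MeasurableEquiv.piFinSuccAbove (fun _ => X) 0).symm.measurable).integrable _

/-- Consecutive pairs of variables are independent of each other in the integrand, so Fubini splits
off two coordinates at a time, following the recursion of `pairWeight`. -/
theorem integral_prod_mul_pairWeight {ι : Type*} {w : ι → X → ℂ}
    (hw : ∀ t, BoundedMeasurable (w t)) {κ : X → X → ℂ}
    (hκ : BoundedMeasurable fun z : X × X => κ z.1 z.2) :
    ∀ (n : ℕ) (τ : Fin n → ι),
      ∫ θ, (∏ i, w (τ i) (θ i)) * pairWeight κ (fun _ => 1) n θ ∂(Measure.pi fun _ => μ) =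
        pairWeight (fun t u => ∫ ψ, ∫ θ, w t θ * w u ψ * κ θ ψ ∂μ ∂μ) (fun t => ∫ θ, w t θ ∂μ) n τ
  | 0, τ => by simp [pairWeight, Measure.real]
  | 1, τ => by
    simp only [pairWeight, mul_one]
    rw [integral_fintype_prod_eq_prod (μ := fun _ => μ) (f := fun i => w (τ i))]
    simp
  | n + 2, τ => by
    have hBM : ∀ (m : ℕ) (τ : Fin m → ι), BoundedMeasurable fun θ : Fin m → X =>
        (∏ i, w (τ i) (θ i)) * pairWeight κ (fun _ => 1) m θ := fun m τ =>
      (BoundedMeasurable.prod _ fun i => (hw (τ i)).comp (measurable_pi_apply i)).mul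
        (BoundedMeasurable.pairWeight hκ m)
    have hint : Integrable (fun z : X × X => w (τ 0) z.1 * w (τ 1) z.2 * κ z.1 z.2) (μ.prod μ) :=
      ((((hw (τ 0)).comp measurable_fst).mul ((hw (τ 1)).comp measurable_snd)).mul hκ).integrable _
    rw [pairWeight, ← integral_prod_mul_pairWeight hw hκ n, integral_fin_succ_fun μ (hBM _ τ)]
    -- Splitting off coordinates leaves the first variable outermost, while the coefficients
    -- integrate it innermost.
    have hswap := integral_integral_swap (f := fun x y => w (τ 0) x * w (τ 1) y * κ x y) hint
    rw [← hswap, ← integral_mul_const]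
    refine integral_congr_ae (Filter.Eventually.of_forall fun x => ?_)
    simp only
    rw [integral_fin_succ_fun μ ((hBM _ τ).comp
      (g := fun θ : Fin (n + 1) → X => (Fin.cons x θ : Fin (n + 2) → X)) (by
        refine measurable_pi_lambda _ fun i => ?_
        refine Fin.cases ?_ (fun j => ?_) i
        · simp
        · simpa using measurable_pi_apply j)), ← integral_mul_const]
    refine integral_congr_ae (Filter.Eventually.of_forall fun y => ?_)
    simp only
    rw [← integral_const_mul]
    refine integral_congr_ae (Filter.Eventually.of_forall fun θ => ?_)
    have h1 : (Fin.cons x (Fin.cons y θ : Fin (n + 1) → X) : Fin (n + 2) → X) 1 = y := rfl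
    simp only [pairWeight, Fin.prod_univ_succ, Fin.cons_zero, Fin.cons_succ, h1]
    have h2 : τ (Fin.succ 0) = τ 1 := rfl
    rw [h2]
    ring

theorem prod_ofFn_sum {ι R : Type*} [Fintype ι] [Ring R] [Algebra ℂ R] {n : ℕ}
    (c : Fin n → ι → ℂ) (e : ι → R) :
    (List.ofFn fun i => ∑ t, c i t • e t).prod =
      ∑ τ : Fin n → ι, (∏ i, c i (τ i)) • (List.ofFn fun i => e (τ i)).prod := by
  have h := (MultilinearMap.mkPiAlgebraFin ℂ n R).map_sum (fun i t => c i t • e t)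
  simp only [MultilinearMap.map_smul_univ] at h
  simpa only [MultilinearMap.mkPiAlgebraFin_apply] using h

section Forms

variable {ι R : Type*} [Fintype ι] [Ring R] [Algebra ℂ R] {w : ι → X → ℂ}
  (e : ι → R) (φ : R →ₗ[ℂ] ℂ)

theorem integral_prod_ofFn_mul (hw : ∀ t, BoundedMeasurable (w t)) {n : ℕ}
    {K : (Fin n → X) → ℂ} (hK : BoundedMeasurable K) :
    ∫ θ, φ (List.ofFn fun i => ∑ t, w t (θ i) • e t).prod * K θ ∂(Measure.pi fun _ => μ) =
      ∑ τ : Fin n → ι, (∫ θ, (∏ i, w (τ i) (θ i)) * K θ ∂(Measure.pi fun _ => μ)) *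
        φ (List.ofFn fun i => e (τ i)).prod := by
  simp only [prod_ofFn_sum, map_sum, map_smul, smul_eq_mul, Finset.sum_mul]
  rw [integral_finsetSum]
  · refine Finset.sum_congr rfl fun τ _ => ?_
    rw [← integral_mul_const]
    exact integral_congr_ae (Filter.Eventually.of_forall fun θ => by ring)
  · intro τ _
    exact (((BoundedMeasurable.prod _ fun i => (hw (τ i)).comp (measurable_pi_apply i)).mul
      (BoundedMeasurable.const _)).mul hK).integrable _

/-- This converts powers of integrated forms into one integral of the pointwise product, to which
the confluent Vandermonde evaluation applies. -/
theorem map_pairForm_eq_integral (hw : ∀ t, BoundedMeasurable (w t)) {κ : X → X → ℂ}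
    (hκ : BoundedMeasurable fun z : X × X => κ z.1 z.2) (n : ℕ) :
    φ (pairForm (∑ t, ∑ u, (∫ ψ, ∫ θ, w t θ * w u ψ * κ θ ψ ∂μ ∂μ) • (e t * e u))
        (∑ t, (∫ θ, w t θ ∂μ) • e t) n) =
      ∫ θ, φ (List.ofFn fun i => ∑ t, w t (θ i) • e t).prod * pairWeight κ (fun _ => 1) n θ
        ∂(Measure.pi fun _ => μ) := by
  rw [integral_prod_ofFn_mul μ e φ hw (BoundedMeasurable.pairWeight hκ n), pairForm_eq_sum, map_sum]
  refine Finset.sum_congr rfl fun τ _ => ?_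
  rw [integral_prod_mul_pairWeight μ hw hκ, map_smul, smul_eq_mul]

/-- With g_i = 1 this treats the power of the single form; with g_i = e^{ikθ}, k being the position
of the factor, it treats the product of the moments. -/
theorem map_prod_ofFn_eq_integral (hw : ∀ t, BoundedMeasurable (w t)) {n : ℕ} {g : Fin n → X → ℂ}
    (hg : ∀ i, BoundedMeasurable (g i)) :
    φ (List.ofFn fun i => ∑ t, (∫ θ, w t θ * g i θ ∂μ) • e t).prod =
      ∫ θ, φ (List.ofFn fun i => ∑ t, w t (θ i) • e t).prod * ∏ i, g i (θ i)
        ∂(Measure.pi fun _ => μ) := by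
  rw [integral_prod_ofFn_mul μ e φ hw (BoundedMeasurable.prod _ fun i =>
    (hg i).comp (measurable_pi_apply i)), prod_ofFn_sum, map_sum]
  refine Finset.sum_congr rfl fun τ _ => ?_
  rw [map_smul, smul_eq_mul]
  simp only [← Finset.prod_mul_distrib]
  rw [integral_fintype_prod_eq_prod (μ := fun _ => μ) (f := fun i x => w (τ i) x * g i x)]

end Forms

theorem integral_comp_perm {N : ℕ} (σ : Equiv.Perm (Fin N)) (f : (Fin N → X) → ℂ) :
    ∫ θ, f (θ ∘ σ) ∂(Measure.pi fun _ => μ) = ∫ θ, f θ ∂(Measure.pi fun _ => μ) := by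
  have h := measurePreserving_piCongrLeft (fun _ : Fin N => μ) σ
  rw [← h.integral_comp']
  refine integral_congr_ae (Filter.Eventually.of_forall fun θ => ?_)
  simp only
  congr 1
  funext i
  rw [MeasurableEquiv.coe_piCongrLeft]
  exact Equiv.piCongrLeft_apply_apply (P := fun _ => X) (e := σ) θ i

/-- Against an antisymmetric function, a function may be replaced by its antisymmetrization. -/
theorem integral_antisymm_mul {N : ℕ} {F K : (Fin N → X) → ℂ} (hF : BoundedMeasurable F)
    (hK : BoundedMeasurable K)
    (hanti : ∀ (σ : Equiv.Perm (Fin N)) θ, F (θ ∘ σ) = ((Equiv.Perm.sign σ : ℤ) : ℂ) * F θ) :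
    (N.factorial : ℂ) * ∫ θ, F θ * K θ ∂(Measure.pi fun _ => μ) =
      ∫ θ, F θ * ∑ σ : Equiv.Perm (Fin N), ((Equiv.Perm.sign σ : ℤ) : ℂ) * K (θ ∘ σ)
        ∂(Measure.pi fun _ => μ) := by
  simp only [Finset.mul_sum]
  rw [integral_finsetSum]
  · have h : ∀ σ : Equiv.Perm (Fin N),
        ∫ θ, F θ * (((Equiv.Perm.sign σ : ℤ) : ℂ) * K (θ ∘ σ)) ∂(Measure.pi fun _ => μ) =
          ∫ θ, F θ * K θ ∂(Measure.pi fun _ => μ) := fun σ => by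
      rw [← integral_comp_perm μ σ (fun θ => F θ * K θ)]
      refine integral_congr_ae (Filter.Eventually.of_forall fun θ => ?_)
      simp only [hanti]
      ring
    simp only [h, Finset.sum_const, Finset.card_univ, Fintype.card_perm, Fintype.card_fin,
      nsmul_eq_mul]
  · intro σ _
    exact (hF.mul ((BoundedMeasurable.const _).mul
      (hK.comp (g := fun θ : Fin N → X => θ ∘ σ) (by
        exact measurable_pi_lambda _ fun i => measurable_pi_apply _)))).integrable _

end Integration

/-! ### The density and the absolute value of the Vandermonde product -/

/-- The arc-length measure on `[-π,π)`. -/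
def circleMeasure : Measure ℝ := volume.restrict (Set.Ico (-Real.pi) Real.pi)

instance : IsFiniteMeasure circleMeasure :=
  ⟨by rw [circleMeasure, Measure.restrict_apply_univ, Real.volume_Ico]; exact ENNReal.ofReal_lt_top⟩

theorem pi_circleMeasure (N : ℕ) : Measure.pi (fun _ : Fin N => circleMeasure) =
    volume.restrict (Set.univ.pi fun _ : Fin N => Set.Ico (-Real.pi) Real.pi) := by
  rw [volume_pi, Measure.restrict_pi_pi]
  rfl

/-- The Vandermonde product of the points `e^{iθ_j}`. -/
def circleVandermonde {N : ℕ} (θ : Fin N → ℝ) : ℂ :=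
  ∏ m, ∏ n ∈ Finset.Ioi m, (Complex.exp (Complex.I * (θ n : ℂ)) -
    Complex.exp (Complex.I * (θ m : ℂ)))

/-- A square root of `-i e^{-iθ}`. -/
def halfPhase (θ : ℝ) : ℂ := Complex.exp (-Complex.I * ((θ : ℂ) + (Real.pi : ℂ) / 2) / 2)

theorem circularDensity_eq_halfPhase_pow {N : ℕ} (hN : 0 < N) (β : ℕ) (θ : ℝ) :
    circularDensity N β θ = halfPhase θ ^ (β * (N - 1)) := by
  rw [circularDensity, halfPhase, ← Complex.exp_nat_mul]
  congr 1
  push_cast [Nat.cast_sub (Nat.one_le_of_lt hN)]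
  ring

theorem norm_halfPhase (θ : ℝ) : ‖halfPhase θ‖ = 1 := by
  rw [halfPhase, show -Complex.I * ((θ : ℂ) + (Real.pi : ℂ) / 2) / 2 =
    ((-(θ + Real.pi / 2) / 2 : ℝ) : ℂ) * Complex.I by push_cast; ring]
  exact Complex.norm_exp_ofReal_mul_I _

/-- Since e^{iψ} - e^{iθ} = 2i sin((ψ - θ)/2) e^{i(θ+ψ)/2}, the two half phases, with product -i
e^{-i(θ+ψ)/2}, leave a real number. -/
theorem exp_sub_exp_mul_halfPhase (θ ψ : ℝ) :
    (Complex.exp (Complex.I * (ψ : ℂ)) - Complex.exp (Complex.I * (θ : ℂ))) *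
      (halfPhase θ * halfPhase ψ) = ((2 * Real.sin ((ψ - θ) / 2) : ℝ) : ℂ) := by
  have h : halfPhase θ * halfPhase ψ =
      -Complex.I * Complex.exp (-Complex.I * ((θ : ℂ) + ψ) / 2) := by
    have h2 : -Complex.I * ((θ : ℂ) + (Real.pi : ℂ) / 2) / 2 +
        -Complex.I * ((ψ : ℂ) + (Real.pi : ℂ) / 2) / 2 =
        -((Real.pi : ℂ) / 2 * Complex.I) + -Complex.I * ((θ : ℂ) + ψ) / 2 := by ring
    rw [halfPhase, halfPhase, ← Complex.exp_add, h2, Complex.exp_add, Complex.exp_neg,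
      Complex.exp_pi_div_two_mul_I, Complex.inv_I]
  have h1 : Complex.exp (Complex.I * (ψ : ℂ)) * Complex.exp (-Complex.I * ((θ : ℂ) + ψ) / 2) =
      Complex.exp (((ψ : ℂ) - θ) / 2 * Complex.I) := by
    rw [← Complex.exp_add]; congr 1; ring
  have h2 : Complex.exp (Complex.I * (θ : ℂ)) * Complex.exp (-Complex.I * ((θ : ℂ) + ψ) / 2) =
      Complex.exp (-(((ψ : ℂ) - θ) / 2) * Complex.I) := by
    rw [← Complex.exp_add]; congr 1; ring
  rw [h]
  push_cast
  rw [Complex.sin, ← h1, ← h2]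
  ring

theorem norm_exp_sub_exp (θ ψ : ℝ) :
    ‖Complex.exp (Complex.I * (ψ : ℂ)) - Complex.exp (Complex.I * (θ : ℂ))‖ =
      |2 * Real.sin ((ψ - θ) / 2)| := by
  have h := congrArg norm (exp_sub_exp_mul_halfPhase θ ψ)
  rw [norm_mul, norm_mul, norm_halfPhase, norm_halfPhase, mul_one, mul_one, Complex.norm_real] at h
  exact h

theorem abs_two_mul_sin_half {x : ℝ} (hx : |x| < 2 * Real.pi) :
    |2 * Real.sin (x / 2)| = Real.sign x * (2 * Real.sin (x / 2)) := by
  obtain ⟨h1, h2⟩ := abs_lt.1 hx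
  rcases lt_trichotomy x 0 with h | rfl | h
  · have := Real.sin_neg_of_neg_of_neg_pi_lt (x := x / 2) (by linarith) (by linarith)
    rw [Real.sign_of_neg h, abs_of_neg (by linarith)]
    ring
  · simp
  · have := Real.sin_pos_of_pos_of_lt_pi (x := x / 2) (by linarith) (by linarith)
    rw [Real.sign_of_pos h, abs_of_pos (by linarith), one_mul]

theorem prod_prod_Ioi_mul {N : ℕ} (a : Fin N → ℂ) :
    ∏ m, ∏ n ∈ Finset.Ioi m, a m * a n = ∏ j, a j ^ (N - 1) := by
  rw [Finset.prod_prod_Ioi_mul_eq_prod_prod_off_diag (fun _ i => a i)]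
  refine Finset.prod_congr rfl fun j _ => ?_
  rw [Finset.prod_const, Finset.card_compl, Finset.card_singleton, Fintype.card_fin]

/-- Each angle lies in N - 1 pairs, and its density is the half phase to the power β(N - 1): exactly
β half phases for each pair that contains it. -/
theorem circleVandermonde_pow_mul_density {N : ℕ} (hN : 0 < N) (β : ℕ) (θ : Fin N → ℝ) :
    circleVandermonde θ ^ β * ∏ j, circularDensity N β (θ j) =
      ∏ m, ∏ n ∈ Finset.Ioi m, ((2 * Real.sin ((θ n - θ m) / 2) : ℝ) : ℂ) ^ β := by
  simp only [circularDensity_eq_halfPhase_pow hN, mul_comm β, pow_mul, Finset.prod_pow]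
  rw [← Finset.prod_pow Finset.univ (N - 1) fun j => halfPhase (θ j), ← prod_prod_Ioi_mul,
    circleVandermonde, ← mul_pow, ← Finset.prod_mul_distrib]
  simp only [← Finset.prod_mul_distrib, exp_sub_exp_mul_halfPhase]

theorem prod_norm_pow_of_even {N : ℕ} (hN : 0 < N) {β : ℕ} (hβ : Even β) (θ : Fin N → ℝ) :
    ((∏ m : Fin N, ∏ n ∈ Finset.Ioi m, ‖Complex.exp (Complex.I * (θ n : ℂ)) -
      Complex.exp (Complex.I * (θ m : ℂ))‖ ^ β : ℝ) : ℂ) =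
      circleVandermonde θ ^ β * ∏ j, circularDensity N β (θ j) := by
  rw [circleVandermonde_pow_mul_density hN]
  simp only [norm_exp_sub_exp, hβ.pow_abs, Complex.ofReal_prod, Complex.ofReal_pow]

/-- Angles in [-π,π) differ by less than 2π, so sin((θ_n - θ_m)/2) has the sign of θ_n - θ_m. An odd
power leaves one such sign per pair. -/
theorem prod_norm_pow_of_odd {N : ℕ} (hN : 0 < N) {β : ℕ} (hβ : Odd β) (θ : Fin N → ℝ)
    (hθ : ∀ j, θ j ∈ Set.Ico (-Real.pi) Real.pi) :
    ((∏ m : Fin N, ∏ n ∈ Finset.Ioi m, ‖Complex.exp (Complex.I * (θ n : ℂ)) -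
      Complex.exp (Complex.I * (θ m : ℂ))‖ ^ β : ℝ) : ℂ) =
      circleVandermonde θ ^ β * (∏ j, circularDensity N β (θ j)) *
        ∏ m, ∏ n ∈ Finset.Ioi m, signKernel (θ m) (θ n) := by
  rw [circleVandermonde_pow_mul_density hN]
  simp only [← Finset.prod_mul_distrib, Complex.ofReal_prod]
  refine Finset.prod_congr rfl fun m _ => Finset.prod_congr rfl fun n _ => ?_
  obtain ⟨k, rfl⟩ := hβ
  have h1 : |θ n - θ m| < 2 * Real.pi := by
    obtain ⟨h1, h2⟩ := hθ n
    obtain ⟨h3, h4⟩ := hθ m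
    rw [abs_lt]
    constructor <;> linarith
  rw [norm_exp_sub_exp, pow_succ, (even_two_mul k).pow_abs, abs_two_mul_sin_half h1, signKernel]
  push_cast
  ring

theorem ofReal_circularPartition (N β : ℕ) :
    (circularPartition N β : ℂ) = (1 / (N.factorial : ℂ)) *
      ∫ θ, ((∏ m : Fin N, ∏ n ∈ Finset.Ioi m, ‖Complex.exp (Complex.I * (θ n : ℂ)) -
        Complex.exp (Complex.I * (θ m : ℂ))‖ ^ β : ℝ) : ℂ)
        ∂(Measure.pi fun _ : Fin N => circleMeasure) := by
  rw [integral_complex_ofReal, pi_circleMeasure, circularPartition]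
  push_cast
  rfl

theorem circularPartition_of_even {N : ℕ} (hN : 0 < N) {β : ℕ} (hβ : Even β) :
    (circularPartition N β : ℂ) = (1 / (N.factorial : ℂ)) *
      ∫ θ, circleVandermonde θ ^ β * ∏ j, circularDensity N β (θ j)
        ∂(Measure.pi fun _ : Fin N => circleMeasure) := by
  simp only [ofReal_circularPartition, prod_norm_pow_of_even hN hβ]

theorem circleVandermonde_comp_perm {N : ℕ} (σ : Equiv.Perm (Fin N)) (θ : Fin N → ℝ) :
    circleVandermonde (θ ∘ σ) = ((Equiv.Perm.sign σ : ℤ) : ℂ) * circleVandermonde θ :=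
  σ.prod_Ioi_comp_eq_sign_mul_prod (f := fun m n => Complex.exp (Complex.I * (θ n : ℂ)) -
    Complex.exp (Complex.I * (θ m : ℂ))) fun _ _ => (neg_sub _ _).symm

/-- The sign identity requires distinct angles. Elsewhere the integrand is zero, so no null-set
argument is needed. -/
theorem circleVandermonde_eq_zero {N : ℕ} {θ : Fin N → ℝ} (hθ : ¬ Function.Injective θ) :
    circleVandermonde θ = 0 := by
  have h : ∃ m n, m < n ∧ θ m = θ n := by
    simp only [Function.Injective, not_forall] at hθ
    obtain ⟨a, b, hab, hne⟩ := hθ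
    rcases lt_or_gt_of_ne hne with h | h
    · exact ⟨a, b, h, hab⟩
    · exact ⟨b, a, h, hab.symm⟩
  obtain ⟨m, n, hmn, he⟩ := h
  exact Finset.prod_eq_zero (Finset.mem_univ m)
    (Finset.prod_eq_zero (Finset.mem_Ioi.2 hmn) (by rw [he, sub_self]))

/-! ### Boundedness and measurability of the integrands -/

theorem boundedMeasurable_exp : BoundedMeasurable fun θ : ℝ => Complex.exp (Complex.I * (θ : ℂ)) :=
  ⟨by fun_prop, 1, fun θ => by
    simp only [mul_comm Complex.I, Complex.norm_exp_ofReal_mul_I, le_refl]⟩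

theorem BoundedMeasurable.pow {X : Type*} [MeasurableSpace X] {f : X → ℂ}
    (hf : BoundedMeasurable f) (n : ℕ) : BoundedMeasurable fun x => f x ^ n := by
  simpa using BoundedMeasurable.prod (Finset.range n) fun _ => hf

theorem boundedMeasurable_circularDensity {N : ℕ} (hN : 0 < N) (β : ℕ) :
    BoundedMeasurable (circularDensity N β) := by
  refine ⟨by unfold circularDensity; fun_prop, 1, fun θ => ?_⟩
  rw [circularDensity_eq_halfPhase_pow hN, norm_pow, norm_halfPhase, one_pow]

theorem boundedMeasurable_wronskianAt {n L : ℕ} (p : Fin n → ℂ[X]) (t : Fin L ↪o Fin n) :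
    BoundedMeasurable (wronskianAt p t) := by
  have hc : Continuous (wronskian fun l => p (t l)) := by
    unfold wronskian
    refine Continuous.matrix_det (continuous_matrix fun i j => ?_)
    exact continuous_const.mul (Polynomial.continuous _)
  refine ⟨?_, ?_⟩
  · exact hc.measurable.comp boundedMeasurable_exp.1
  · obtain ⟨C, hC⟩ := (isCompact_sphere (0 : ℂ) 1).exists_bound_of_continuousOn hc.continuousOn
    refine ⟨C, fun θ => hC _ ?_⟩
    rw [mem_sphere_zero_iff_norm, mul_comm, Complex.norm_exp_ofReal_mul_I]

theorem boundedMeasurable_signKernel :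
    BoundedMeasurable fun z : ℝ × ℝ => signKernel z.1 z.2 / 2 := by
  refine ⟨?_, 1, fun z => ?_⟩
  · have hs : Measurable Real.sign :=
      Measurable.ite measurableSet_Iio measurable_const
        (Measurable.ite measurableSet_Ioi measurable_const measurable_const)
    unfold signKernel
    exact (Complex.measurable_ofReal.comp (hs.comp (by fun_prop))).div_const _
  · simp only [signKernel, norm_div, Complex.norm_real]
    rcases Real.sign_apply_eq (z.2 - z.1) with h | h | h <;> rw [h] <;> norm_num

theorem boundedMeasurable_circleVandermonde (N : ℕ) :
    BoundedMeasurable (circleVandermonde (N := N)) := by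
  refine BoundedMeasurable.prod _ fun m => BoundedMeasurable.prod _ fun n => ?_
  have h1 := boundedMeasurable_exp.comp (measurable_pi_apply (X := fun _ : Fin N => ℝ) n)
  have h2 := boundedMeasurable_exp.comp (measurable_pi_apply (X := fun _ : Fin N => ℝ) m)
  simpa [sub_eq_add_neg] using h1.add ((BoundedMeasurable.const (-1)).mul h2)

theorem boundedMeasurable_vandermonde_density {N : ℕ} (hN : 0 < N) (k β : ℕ) :
    BoundedMeasurable fun θ : Fin N → ℝ =>
      circleVandermonde θ ^ k * ∏ j, circularDensity N β (θ j) :=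
  ((boundedMeasurable_circleVandermonde N).pow k).mul (BoundedMeasurable.prod _ fun j =>
    (boundedMeasurable_circularDensity hN β).comp (measurable_pi_apply j))

/-! ### The forms as integrals -/

/-- The coefficients of `ω(e^{iθ}) dμ(θ)`. -/
def weightedWronskian {n L : ℕ} (N β : ℕ) (p : Fin n → ℂ[X]) (t : Fin L ↪o Fin n) (θ : ℝ) : ℂ :=
  wronskianAt p t θ * circularDensity N β θ

theorem boundedMeasurable_weightedWronskian {n L N : ℕ} (hN : 0 < N) (β : ℕ) (p : Fin n → ℂ[X])
    (t : Fin L ↪o Fin n) : BoundedMeasurable (weightedWronskian N β p t) :=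
  (boundedMeasurable_wronskianAt p t).mul (boundedMeasurable_circularDensity hN β)

theorem volumeCoeff_prod_weightedWronskian {N L : ℕ} (β : ℕ) (p : Fin (N * L) → ℂ[X])
    (hp : IsCompleteMonic p) (θ : Fin N → ℝ) :
    volumeCoeff (N * L) (List.ofFn fun j => ∑ t : Fin L ↪o Fin (N * L),
      weightedWronskian N β p t (θ j) • wedgeBasis t).prod =
      circleVandermonde θ ^ (L ^ 2) * ∏ j, circularDensity N β (θ j) := by
  have h : ∀ j, ∑ t : Fin L ↪o Fin (N * L), weightedWronskian N β p t (θ j) • wedgeBasis t =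
      circularDensity N β (θ j) • wronskianForm (L := L) p (θ j) := fun j => by
    rw [wronskianForm, Finset.smul_sum]
    refine Finset.sum_congr rfl fun t _ => ?_
    rw [smul_smul, weightedWronskian, mul_comm (circularDensity N β (θ j))]
  have h2 := (MultilinearMap.mkPiAlgebraFin ℂ N (ExteriorAlgebra ℂ (Fin (N * L) → ℂ))).map_smul_univ
    (fun j => circularDensity N β (θ j)) (fun j => wronskianForm (L := L) p (θ j))
  simp only [MultilinearMap.mkPiAlgebraFin_apply] at h2
  simp only [h]
  rw [h2, map_smul, volumeCoeff_prod_wronskianForm p hp, smul_eq_mul, mul_comm]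
  rfl

theorem singleForm_eq (N L β : ℕ) (p : Fin (N * L) → ℂ[X]) :
    singleForm N L β p = ∑ t : Fin L ↪o Fin (N * L),
      (∫ θ, weightedWronskian N β p t θ ∂circleMeasure) • wedgeBasis t :=
  rfl

theorem doubleForm_eq (N L β : ℕ) (p : Fin (N * L) → ℂ[X]) (κ : ℝ → ℝ → ℂ) :
    doubleForm N L β p κ = ∑ t : Fin L ↪o Fin (N * L), ∑ u : Fin L ↪o Fin (N * L),
      (∫ ψ, ∫ θ, weightedWronskian N β p t θ * weightedWronskian N β p u ψ * (κ θ ψ / 2)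
        ∂circleMeasure ∂circleMeasure) • (wedgeBasis t * wedgeBasis u) := by
  refine Finset.sum_congr rfl fun t _ => Finset.sum_congr rfl fun u _ => ?_
  congr 1
  rw [circularIntegral, ← integral_const_mul]
  refine integral_congr_ae (Filter.Eventually.of_forall fun ψ => ?_)
  simp only
  rw [circularIntegral, ← integral_mul_const, ← integral_const_mul]
  refine integral_congr_ae (Filter.Eventually.of_forall fun θ => ?_)
  simp only [weightedWronskian]
  ring

/-! ### The four identities -/

theorem circularPartition_eq_hyperpfaffian_singleForm {N L : ℕ} (hN : 0 < N)
    (p : Fin (N * L) → ℂ[X]) (hp : IsCompleteMonic p) (hL : Even (L ^ 2)) :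
    (circularPartition N (L ^ 2) : ℂ) = hyperpfaffian N (singleForm N L (L ^ 2) p) := by
  have h := map_prod_ofFn_eq_integral circleMeasure
    (fun t : Fin L ↪o Fin (N * L) => wedgeBasis t) (volumeCoeff (N * L))
    (fun t => boundedMeasurable_weightedWronskian hN (L ^ 2) p t)
    (n := N) (g := fun _ _ => 1) (fun _ => BoundedMeasurable.const 1)
  simp only [mul_one, ← singleForm_eq, Finset.prod_const_one, List.ofFn_const, List.prod_replicate,
    volumeCoeff_prod_weightedWronskian (L ^ 2) p hp] at h
  rw [circularPartition_of_even hN hL, hyperpfaffian, map_smul, h, smul_eq_mul]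

theorem vandermonde_density_antisymm {N k : ℕ} (hk : Odd k) (β : ℕ) (σ : Equiv.Perm (Fin N))
    (θ : Fin N → ℝ) :
    circleVandermonde (θ ∘ σ) ^ k * ∏ j, circularDensity N β ((θ ∘ σ) j) =
      ((Equiv.Perm.sign σ : ℤ) : ℂ) *
        (circleVandermonde θ ^ k * ∏ j, circularDensity N β (θ j)) := by
  have h1 : ∏ j, circularDensity N β ((θ ∘ σ) j) = ∏ j, circularDensity N β (θ j) :=
    Equiv.prod_comp σ fun j => circularDensity N β (θ j)
  have h2 : ((Equiv.Perm.sign σ : ℤ) : ℂ) ^ k = ((Equiv.Perm.sign σ : ℤ) : ℂ) := by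
    rcases Int.units_eq_one_or (Equiv.Perm.sign σ) with h | h <;> simp [h, hk.neg_one_pow]
  rw [h1, circleVandermonde_comp_perm, mul_pow, h2, mul_assoc]

/-- An odd power of Δ is antisymmetric, so N! times the coefficient is an integral against the
antisymmetrized pair weight. That is ⌊N/2⌋! times the product of signs relating Δ^{L²} dμ to
|Δ|^{L²}. Both parities of N follow. -/
theorem volumeCoeff_pairForm_signKernel {N L : ℕ} (hN : 0 < N)
    (p : Fin (N * L) → ℂ[X]) (hp : IsCompleteMonic p) (hL : Odd (L ^ 2)) :
    volumeCoeff (N * L) (pairForm (doubleForm N L (L ^ 2) p signKernel)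
      (singleForm N L (L ^ 2) p) N) =
      ((N / 2).factorial : ℂ) * (circularPartition N (L ^ 2) : ℂ) := by
  have h := map_pairForm_eq_integral circleMeasure
    (fun t : Fin L ↪o Fin (N * L) => wedgeBasis t) (volumeCoeff (N * L))
    (fun t => boundedMeasurable_weightedWronskian hN (L ^ 2) p t)
    (κ := fun x y => signKernel x y / 2) boundedMeasurable_signKernel N
  simp only [volumeCoeff_prod_weightedWronskian (L ^ 2) p hp] at h
  have h2 := integral_antisymm_mul circleMeasure
    (boundedMeasurable_vandermonde_density hN (L ^ 2) (L ^ 2))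
    (BoundedMeasurable.pairWeight (κ := fun x y => signKernel x y / 2)
      boundedMeasurable_signKernel N)
    (vandermonde_density_antisymm hL (L ^ 2))
  rw [← h, ← doubleForm_eq, ← singleForm_eq] at h2
  have h3 : ∫ θ, circleVandermonde θ ^ (L ^ 2) * (∏ j, circularDensity N (L ^ 2) (θ j)) *
      ∑ σ : Equiv.Perm (Fin N), ((Equiv.Perm.sign σ : ℤ) : ℂ) *
        pairWeight (fun x y => signKernel x y / 2) (fun _ => 1) N (θ ∘ σ)
        ∂(Measure.pi fun _ : Fin N => circleMeasure) =
      ∫ θ, ((N / 2).factorial : ℂ) * ((∏ m : Fin N, ∏ n ∈ Finset.Ioi m,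
        ‖Complex.exp (Complex.I * (θ n : ℂ)) -
          Complex.exp (Complex.I * (θ m : ℂ))‖ ^ (L ^ 2) : ℝ) : ℂ)
        ∂(Measure.pi fun _ : Fin N => circleMeasure) := by
    rw [pi_circleMeasure]
    refine setIntegral_congr_fun (MeasurableSet.univ_pi fun _ => measurableSet_Ico) fun θ hθ => ?_
    rw [prod_norm_pow_of_odd hN hL θ fun j => hθ j (Set.mem_univ j)]
    by_cases hi : Function.Injective θ
    · rw [sum_sign_mul_pairWeight_signKernel θ hi]
      ring
    · rw [circleVandermonde_eq_zero hi, zero_pow hL.pos.ne']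
      ring
  rw [h3, integral_const_mul] at h2
  rw [ofReal_circularPartition]
  have hne : (N.factorial : ℂ) ≠ 0 := by exact_mod_cast (Nat.factorial_pos _).ne'
  field_simp
  linear_combination h2

theorem circularPartition_eq_hyperpfaffian_signKernel {L M : ℕ} (hN : 0 < 2 * M)
    (p : Fin (2 * M * L) → ℂ[X]) (hp : IsCompleteMonic p) (hL : Odd (L ^ 2)) :
    (circularPartition (2 * M) (L ^ 2) : ℂ) =
      hyperpfaffian M (doubleForm (2 * M) L (L ^ 2) p signKernel) := by
  have h := volumeCoeff_pairForm_signKernel hN p hp hL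
  rw [pairForm_even, Nat.mul_div_cancel_left _ two_pos] at h
  rw [hyperpfaffian, map_smul, h, smul_eq_mul]
  have hne : (M.factorial : ℂ) ≠ 0 := by exact_mod_cast (Nat.factorial_pos _).ne'
  field_simp

theorem circularPartition_eq_hyperpfaffian_bordered {L K : ℕ}
    (p : Fin ((2 * K + 1) * L) → ℂ[X]) (hp : IsCompleteMonic p) (hL : Odd (L ^ 2)) :
    (circularPartition (2 * K + 1) (L ^ 2) : ℂ) =
      hyperpfaffian (K + 1)
        (extendForm (2 * K + 1) L (doubleForm (2 * K + 1) L (L ^ 2) p signKernel) +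
          extendForm (2 * K + 1) L (singleForm (2 * K + 1) L (L ^ 2) p) *
            borderForm (2 * K + 1) L) := by
  have h := volumeCoeff_pairForm_signKernel (Nat.succ_pos _) p hp hL
  rw [pairForm_odd, show (2 * K + 1) / 2 = K by omega] at h
  rw [hyperpfaffian_bordered (Nat.Odd.of_mul_left (sq L ▸ hL)) rfl (doubleForm_mem _ _ _ _ _)
    (singleForm_mem _ _ _ _), h]
  have hne : (K.factorial : ℂ) ≠ 0 := by exact_mod_cast (Nat.factorial_pos _).ne'
  field_simp

/-! ### The kernel for β = L² + 1 -/

/-- The nested product `u_{m-1} ⋯ u_0 v_0 ⋯ v_{m-1}`. -/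
def nestedProd {R : Type*} [Ring R] (u v : ℕ → R) : ℕ → R
  | 0 => 1
  | m + 1 => u m * nestedProd u v m * v m

/-- The products u_j v_j commute and square to zero, so the m-th power is m! times their product.
Moving u_m across a power of ∑_{j<m} u_j v_j costs no sign, which allows the nested order. The
vanishing of the next power drives the induction. -/
theorem sum_mul_pow_eq_nestedProd {R : Type*} [Ring R] {u v : ℕ → R}
    (huu : ∀ i j, u i * u j = -(u j * u i)) (hvu : ∀ i j, v i * u j = -(u j * v i))
    (hvv : ∀ i j, v i * v j = -(v j * v i)) (hsq : ∀ i, u i * u i = 0) (m : ℕ) :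
    (∑ j ∈ Finset.range m, u j * v j) ^ m = m.factorial • nestedProd u v m ∧
      (∑ j ∈ Finset.range m, u j * v j) ^ (m + 1) = 0 := by
  induction m with
  | zero => simp [nestedProd]
  | succ m ih =>
    set B := ∑ j ∈ Finset.range m, u j * v j with hB
    have hBu : Commute B (u m) :=
      Commute.sum_left _ _ _ fun j _ => commute_mul_of_anticomm (huu j m) (hvu j m)
    have hBv : Commute B (v m) := Commute.sum_left _ _ _ fun j _ =>
      commute_mul_of_anticomm (by rw [hvu m j, neg_neg]) (hvv j m)
    have hc : Commute B (u m * v m) := hBu.mul_right hBv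
    have hz : u m * v m * (u m * v m) = 0 := by
      rw [mul_assoc, ← mul_assoc (v m), hvu, neg_mul, mul_neg, ← mul_assoc, ← mul_assoc, hsq,
        zero_mul, zero_mul, neg_zero]
    rw [Finset.sum_range_succ, ← hB]
    constructor
    · rw [add_pow_of_commute_of_mul_self hc hz, ih.2, zero_add, ← mul_assoc,
        (hBu.pow_left m).eq, ih.1, mul_smul_comm, smul_mul_assoc, smul_smul, nestedProd,
        Nat.factorial_succ]
    · rw [add_pow_of_commute_of_mul_self hc hz, pow_succ, ih.2, zero_mul, zero_mul, smul_zero,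
        add_zero]

/-- The left factors run down from M - 1 and the right ones up from M, so the nest reads consecutive
indices without reordering. -/
theorem nestedProd_eq_prod_ofFn {R : Type*} [Ring R] (W : ℕ → R) (M m : ℕ) (hm : m ≤ M) :
    nestedProd (fun j => W (M - 1 - j)) (fun j => W (M + j)) m =
      (List.ofFn fun i : Fin (2 * m) => W (M - m + i)).prod := by
  induction m with
  | zero => simp [nestedProd]
  | succ m ih =>
    rw [nestedProd, ih (by omega), show 2 * (m + 1) = 2 * m + 1 + 1 by ring, List.ofFn_succ,
      List.ofFn_succ', List.prod_cons, List.concat_eq_append, List.prod_append, mul_assoc,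
      List.prod_singleton]
    congr 1
    · congr 1
      simp only [Fin.val_zero]
      omega
    · congr 1
      · congr 2
        funext i
        congr 1
        simp only [Fin.val_succ, Fin.val_castSucc]
        omega
      · congr 1
        simp only [Fin.val_succ, Fin.val_last]
        omega

/-- The sum equals y^M - x^M times the geometric sum for (y^M - x^M)/(y - x). -/
theorem sub_mul_sum_pow_antidiagonal (x y : ℂ) (M : ℕ) :
    (∑ j ∈ Finset.range M, (x ^ (M - 1 - j) * y ^ (M + j) - x ^ (M + j) * y ^ (M - 1 - j))) *
      (y - x) = (y ^ M - x ^ M) ^ 2 := by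
  have h1 := geom_sum₂_mul y x M
  have h2 : ∑ j ∈ Finset.range M, x ^ (M - 1 - j) * y ^ (M + j) =
      y ^ M * ∑ i ∈ Finset.range M, y ^ i * x ^ (M - 1 - i) := by
    rw [Finset.mul_sum]
    exact Finset.sum_congr rfl fun j _ => by rw [pow_add]; ring
  have h3 : ∑ j ∈ Finset.range M, x ^ (M + j) * y ^ (M - 1 - j) =
      x ^ M * ∑ i ∈ Finset.range M, y ^ i * x ^ (M - 1 - i) := by
    rw [Finset.mul_sum, ← Finset.sum_range_reflect]
    refine Finset.sum_congr rfl fun j hj => ?_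
    have : j < M := Finset.mem_range.1 hj
    rw [pow_add, show M - 1 - (M - 1 - j) = j by omega]
    ring
  rw [Finset.sum_sub_distrib, h2, h3]
  linear_combination (y ^ M - x ^ M) * h1

theorem powerKernel_eq_sum (M : ℕ) (θ ψ : ℝ) :
    powerKernel M θ ψ = ∑ j ∈ Finset.range M,
      (Complex.exp (Complex.I * (θ : ℂ)) ^ (M - 1 - j) *
          Complex.exp (Complex.I * (ψ : ℂ)) ^ (M + j) -
        Complex.exp (Complex.I * (θ : ℂ)) ^ (M + j) *
          Complex.exp (Complex.I * (ψ : ℂ)) ^ (M - 1 - j)) := by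
  have hpow : ∀ φ : ℝ, Complex.exp (Complex.I * (M : ℂ) * (φ : ℂ)) =
      Complex.exp (Complex.I * (φ : ℂ)) ^ M := fun φ => by
    rw [← Complex.exp_nat_mul]; congr 1; ring
  rw [powerKernel, hpow, hpow, ← sub_mul_sum_pow_antidiagonal]
  by_cases h : Complex.exp (Complex.I * (ψ : ℂ)) = Complex.exp (Complex.I * (θ : ℂ))
  -- At coinciding points the quotient is 0 by convention, and the sum vanishes term by term.
  · rw [h, sub_self, div_zero]
    exact (Finset.sum_eq_zero fun j _ => by ring).symm
  · rw [mul_div_cancel_right₀ _ (sub_ne_zero.2 h)]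

/-- The form `∫ ω(e^{iθ}) e^{ikθ} dμ(θ)`. -/
def momentForm (N L β : ℕ) (p : Fin (N * L) → ℂ[X]) (k : ℕ) :
    ExteriorAlgebra ℂ (Fin (N * L) → ℂ) :=
  ∑ t : Fin L ↪o Fin (N * L), (∫ θ, weightedWronskian N β p t θ *
    Complex.exp (Complex.I * (θ : ℂ)) ^ k ∂circleMeasure) • wedgeBasis t

theorem momentForm_mem (N L β : ℕ) (p : Fin (N * L) → ℂ[X]) (k : ℕ) :
    momentForm N L β p k ∈ ⋀[ℂ]^L (Fin (N * L) → ℂ) :=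
  Submodule.sum_mem _ fun t _ => Submodule.smul_mem _ _ (wedgeBasis_mem t)

theorem sum_smul_mul_sum_smul {ι R : Type*} [Fintype ι] [Ring R] [Algebra ℂ R] (a b : ι → ℂ)
    (e : ι → R) :
    (∑ t, a t • e t) * ∑ u, b u • e u = ∑ t, ∑ u, (a t * b u) • (e t * e u) := by
  simp only [Finset.sum_mul_sum, smul_mul_smul_comm]

/-- The expanded kernel separates the two integrals. For odd L the exchanged product of moments is
minus the original, so the two halves add up. -/
theorem doubleForm_powerKernel {N L : ℕ} (hN : 0 < N) (hL : Odd L) (β M : ℕ)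
    (p : Fin (N * L) → ℂ[X]) :
    doubleForm N L β p (powerKernel M) = ∑ j ∈ Finset.range M,
      momentForm N L β p (M - 1 - j) * momentForm N L β p (M + j) := by
  set w : (Fin L ↪o Fin (N * L)) → ℝ → ℂ := weightedWronskian N β p with hw
  set z : ℝ → ℂ := fun θ => Complex.exp (Complex.I * (θ : ℂ)) with hz
  set c : (Fin L ↪o Fin (N * L)) → ℕ → ℂ := fun t k => ∫ θ, w t θ * z θ ^ k ∂circleMeasure with hc
  have hI : ∀ t k, Integrable (fun θ => w t θ * z θ ^ k) circleMeasure := fun t k =>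
    ((boundedMeasurable_weightedWronskian hN β p t).mul
      (boundedMeasurable_exp.pow k)).integrable _
  have hcoef : ∀ t u, ∫ ψ, ∫ θ, w t θ * w u ψ * (powerKernel M θ ψ / 2)
      ∂circleMeasure ∂circleMeasure = ∑ j ∈ Finset.range M,
        (1 / 2 * (c t (M - 1 - j) * c u (M + j)) - 1 / 2 * (c t (M + j) * c u (M - 1 - j))) := by
    intro t u
    have hinner : ∀ ψ, ∫ θ, w t θ * w u ψ * (powerKernel M θ ψ / 2) ∂circleMeasure =
        ∑ j ∈ Finset.range M, (1 / 2 * c t (M - 1 - j) * (w u ψ * z ψ ^ (M + j)) -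
          1 / 2 * c t (M + j) * (w u ψ * z ψ ^ (M - 1 - j))) := by
      intro ψ
      have h : ∀ θ, w t θ * w u ψ * (powerKernel M θ ψ / 2) = ∑ j ∈ Finset.range M,
          (w t θ * z θ ^ (M - 1 - j) * (1 / 2 * (w u ψ * z ψ ^ (M + j))) -
            w t θ * z θ ^ (M + j) * (1 / 2 * (w u ψ * z ψ ^ (M - 1 - j)))) := fun θ => by
        rw [powerKernel_eq_sum, Finset.sum_div, Finset.mul_sum]
        exact Finset.sum_congr rfl fun j _ => by ring
      simp only [h]
      rw [integral_finsetSum]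
      swap
      · exact fun j _ => ((hI t _).mul_const _).sub ((hI t _).mul_const _)
      refine Finset.sum_congr rfl fun j _ => ?_
      rw [integral_sub ((hI t _).mul_const _) ((hI t _).mul_const _), integral_mul_const,
        integral_mul_const]
      ring
    simp only [hinner]
    rw [integral_finsetSum]
    swap
    · exact fun j _ => ((hI u _).const_mul _).sub ((hI u _).const_mul _)
    refine Finset.sum_congr rfl fun j _ => ?_
    rw [integral_sub ((hI u _).const_mul _) ((hI u _).const_mul _), integral_const_mul,
      integral_const_mul]
    ring
  rw [doubleForm_eq]
  simp only [← hw, hcoef, Finset.sum_smul]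
  have hswap : ∀ f : (Fin L ↪o Fin (N * L)) → (Fin L ↪o Fin (N * L)) → ℕ →
      ExteriorAlgebra ℂ (Fin (N * L) → ℂ), ∑ t, ∑ u, ∑ j ∈ Finset.range M, f t u j =
        ∑ j ∈ Finset.range M, ∑ t, ∑ u, f t u j := fun f => by
    rw [Finset.sum_comm]
    simp only [Finset.sum_comm (s := Finset.univ) (t := Finset.range M)]
    exact Finset.sum_congr rfl fun j _ => Finset.sum_comm
  rw [hswap]
  refine Finset.sum_congr rfl fun j _ => ?_
  have h1 := sum_smul_mul_sum_smul (fun t => c t (M - 1 - j)) (fun u => c u (M + j))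
    (fun t : Fin L ↪o Fin (N * L) => wedgeBasis t)
  have h2 := sum_smul_mul_sum_smul (fun t => c t (M + j)) (fun u => c u (M - 1 - j))
    (fun t : Fin L ↪o Fin (N * L) => wedgeBasis t)
  have h3 := exteriorPower_mul_anticomm hL hL (momentForm_mem N L β p (M + j))
    (momentForm_mem N L β p (M - 1 - j))
  simp only [sub_smul, mul_smul (1 / 2 : ℂ), Finset.sum_sub_distrib, ← Finset.smul_sum]
  rw [← h1, ← h2]
  change (1 / 2 : ℂ) • (momentForm N L β p (M - 1 - j) * momentForm N L β p (M + j)) -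
    (1 / 2 : ℂ) • (momentForm N L β p (M + j) * momentForm N L β p (M - 1 - j)) = _
  rw [h3, smul_neg, sub_neg_eq_add, ← add_smul]
  norm_num

/-- The volume coefficient of W_0 ∧ ⋯ ∧ W_{2M-1} integrates Δ^{L²} against a monomial in the
e^{iθ_k}. Since L² is odd, the monomial may be antisymmetrized to Δ, and Δ^{L²+1} has even exponent,
so no signs are needed. -/
theorem circularPartition_eq_hyperpfaffian_powerKernel {L M : ℕ} (hN : 0 < 2 * M)
    (p : Fin (2 * M * L) → ℂ[X]) (hp : IsCompleteMonic p) (hL : Even (L ^ 2 + 1)) :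
    (circularPartition (2 * M) (L ^ 2 + 1) : ℂ) =
      hyperpfaffian M (doubleForm (2 * M) L (L ^ 2 + 1) p (powerKernel M)) := by
  have hL2 : Odd (L ^ 2) := by
    rw [← Nat.not_even_iff_odd]
    exact fun h => Nat.not_even_iff_odd.2 h.add_one hL
  have hLo : Odd L := Nat.Odd.of_mul_left (sq L ▸ hL2)
  set W := momentForm (2 * M) L (L ^ 2 + 1) p with hW
  have anti : ∀ i j, W i * W j = -(W j * W i) := fun i j =>
    exteriorPower_mul_anticomm hLo hLo (momentForm_mem _ _ _ _ _) (momentForm_mem _ _ _ _ _)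
  have hpow : doubleForm (2 * M) L (L ^ 2 + 1) p (powerKernel M) ^ M =
      M.factorial • (List.ofFn fun i : Fin (2 * M) => W i).prod := by
    rw [doubleForm_powerKernel hN hLo, (sum_mul_pow_eq_nestedProd (u := fun j => W (M - 1 - j))
      (v := fun j => W (M + j)) (fun _ _ => anti _ _) (fun _ _ => anti _ _) (fun _ _ => anti _ _)
      (fun _ => exteriorPower_mul_self hLo (momentForm_mem _ _ _ _ _)) M).1,
      nestedProd_eq_prod_ofFn W M M le_rfl]
    simp only [Nat.sub_self, zero_add]
  have hg : ∀ i : Fin (2 * M), BoundedMeasurable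
      fun θ : ℝ => Complex.exp (Complex.I * (θ : ℂ)) ^ (i : ℕ) := fun i =>
    boundedMeasurable_exp.pow i
  have h := map_prod_ofFn_eq_integral circleMeasure
    (fun t : Fin L ↪o Fin (2 * M * L) => wedgeBasis t) (volumeCoeff (2 * M * L))
    (fun t => boundedMeasurable_weightedWronskian hN (L ^ 2 + 1) p t) hg
  simp only [volumeCoeff_prod_weightedWronskian (L ^ 2 + 1) p hp] at h
  have h2 := integral_antisymm_mul circleMeasure
    (boundedMeasurable_vandermonde_density hN (L ^ 2) (L ^ 2 + 1))
    (BoundedMeasurable.prod Finset.univ fun i => (hg i).comp (measurable_pi_apply i))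
    (vandermonde_density_antisymm hL2 (L ^ 2 + 1))
  -- The Leibniz expansion of the Vandermonde determinant.
  have hdet : ∀ θ : Fin (2 * M) → ℝ,
      ∑ σ : Equiv.Perm (Fin (2 * M)), ((Equiv.Perm.sign σ : ℤ) : ℂ) *
        ∏ i, Complex.exp (Complex.I * (((θ ∘ σ) i : ℝ) : ℂ)) ^ (i : ℕ) = circleVandermonde θ := by
    intro θ
    rw [circleVandermonde, ← Matrix.det_vandermonde fun i => Complex.exp (Complex.I * (θ i : ℂ)),
      Matrix.det_apply']
    rfl
  simp only [hdet] at h2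
  rw [← h] at h2
  rw [circularPartition_of_even hN hL, hyperpfaffian, map_smul, hpow, map_nsmul, nsmul_eq_mul,
    smul_eq_mul]
  have hWprod : (List.ofFn fun i : Fin (2 * M) => W i).prod = (List.ofFn fun i : Fin (2 * M) =>
      ∑ t : Fin L ↪o Fin (2 * M * L), (∫ θ, weightedWronskian (2 * M) (L ^ 2 + 1) p t θ *
        Complex.exp (Complex.I * (θ : ℂ)) ^ (i : ℕ) ∂circleMeasure) • wedgeBasis t).prod := rfl
  rw [hWprod]
  have h4 : ∀ θ : Fin (2 * M) → ℝ, circleVandermonde θ ^ (L ^ 2 + 1) *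
      ∏ j, circularDensity (2 * M) (L ^ 2 + 1) (θ j) =
        circleVandermonde θ ^ (L ^ 2) * (∏ j, circularDensity (2 * M) (L ^ 2 + 1) (θ j)) *
          circleVandermonde θ := fun θ => by ring
  simp only [h4]
  rw [← h2]
  have hne : (M.factorial : ℂ) ≠ 0 := by exact_mod_cast (Nat.factorial_pos _).ne'
  have hne2 : ((2 * M).factorial : ℂ) ≠ 0 := by exact_mod_cast (Nat.factorial_pos _).ne'
  field_simp

theorem theorem2 (N L : ℕ) (hN : 0 < N) (hL : 0 < L)
    (p : Fin (N * L) → Polynomial ℂ) (hp : IsCompleteMonic p) :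
    (Even (L ^ 2) →
      (circularPartition N (L ^ 2) : ℂ) = hyperpfaffian N (singleForm N L (L ^ 2) p)) ∧
    (Odd (L ^ 2) → ∀ M : ℕ, N = 2 * M →
      (circularPartition N (L ^ 2) : ℂ) =
        hyperpfaffian M (doubleForm N L (L ^ 2) p signKernel)) ∧
    (Odd (L ^ 2) → ∀ K : ℕ, N + 1 = 2 * K →
      (circularPartition N (L ^ 2) : ℂ) =
        hyperpfaffian K
          (extendForm N L (doubleForm N L (L ^ 2) p signKernel) +
            extendForm N L (singleForm N L (L ^ 2) p) * borderForm N L)) ∧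
    (Even (L ^ 2 + 1) → ∀ M : ℕ, N = 2 * M →
      (circularPartition N (L ^ 2 + 1) : ℂ) =
        hyperpfaffian M (doubleForm N L (L ^ 2 + 1) p (powerKernel M))) := by
  refine ⟨circularPartition_eq_hyperpfaffian_singleForm hN p hp, ?_, ?_, ?_⟩
  · rintro h M rfl
    exact circularPartition_eq_hyperpfaffian_signKernel hN p hp h
  · intro h K hK
    obtain ⟨k, rfl⟩ : ∃ k, K = k + 1 := ⟨K - 1, by omega⟩
    obtain rfl : N = 2 * k + 1 := by omega
    exact circularPartition_eq_hyperpfaffian_bordered p hp h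
  · rintro h M rfl
    exact circularPartition_eq_hyperpfaffian_powerKernel hN p hp h

end
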